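/- Let $k>2$ be an integer, $p$ a prime, $\mathbb F=\mathbb F_p$, and let $\varphi\in\mathbb F[t]$ be a primitive polynomial, i.e. $\varphi$ is irreducible and the class of $t$ generates the multiplicative group of the field $R=\mathbb F[t]/(\varphi)$. For $i\in\{1,\dots,k+1\}$ and $\alpha\in\mathbb F$ let $h_i(\alpha)=I_{k+1}+e_{i,i+1}(\alpha t)\in \mathrm{SL}_{k+1}(R)$, where $e_{i,i+1}(\alpha t)$ is the matrix whose only nonzero entry is $\alpha t$ in position $(i,i+1)$ and indices are taken modulo $k+1$. Let $H_i=\{h_i(\alpha):\alpha\in\mathbb F\}$, $G=\langle H_1,\dots,H_{k+1}\rangle$ and $K_i=\langle H_j: j\ne i\rangle$. Let $X=X[G;K_1,\dots,K_{k+1}]$ be the $k$-dimensional coset complex: its vertices of color $i$ are the left cosets $gK_i$, and a set of vertices is a face if these cosets have a common element. $X(m)$ denotes the set of faces with $m+1$ vertices, and $X_{+s}(m)=\{t\in X(m): t\supseteq s\}$. The face $\{gK_1,\dots,gK_{k+1}\}\in X(k)$ is identified with $g\in G$. Let $RS(p,d)\subseteq\mathbb F^{\mathbb F}$ be the Reed–Solomon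 code of evaluations on $\mathbb F$ of univariate polynomials of degree at most $d$, where $d\ge 0$ is an integer with $d<p/4$. For $t\in X(k-1)$ with missing color $i$, the set $X_{+t}(k)$ is a coset $gH_i$, and $C_t$ is the set of all $f:X_{+t}(k)\to\mathbb F$ such that $\alpha\mapsto f(gh_i(\alpha))$ lies in $RS(p,d)$. For a face $s$ of smaller dimension let $$C_s=\{f:X_{+s}(k)\to\mathbb F \;:\; f|_{X_{+t}(k)}\in C_t \text{ for all } t\in X_{+s}(k-1)\}.$$ Let $$C_{d,d}=\{f:\mathbb F^3\to\mathbb F \;:\; \forall a,b,c\in\mathbb F,\ \deg_x f(x,b,c)\le d \text{ and } \deg_y f(a,y,ay+c)\le d\}.$$ Two codes are called isomorphic if some bijection between their coordinate sets carries one onto the other. Let $s\in X(k-2)$, and let $i\neq j$ be the two colors that do not occur in $s$. If $i-j\equiv\pm1 \pmod{k+1}$, then $C_s$ is isomorphic to $C_{d,d}$. Otherwise $C_s$ is isomorphic to the tensor code $RS(p,d)\otimes RS(p,d)$. In both cases $C_s$ is $(\epsilon,\rho)$-agreement testable with $$\epsilon=\Big(\frac{p-4d}{5p}\Big)^3>0,\qquad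 \rho(x)=4x^{1/3},$$ that is: let $X_s$ be the link of $s$ (a graph), with vertex set $X_s(0)=\{v\notin s: s\cup\{v\}\in X\}$ and edge set $X_s(1)=\{\{u,v\}: u\neq v,\ u,v\notin s,\ s\cup\{u,v\}\in X\}$. Given any collection $z_v\in C_{s\cup\{v\}}$, $v\in X_s(0)$, put $$\alpha=\Pr_{uv\in X_s(1)}\big[z_u(s\cup\{u,v\})\neq z_v(s\cup\{u,v\})\big]$$ for a uniformly random edge $uv$. If $\alpha<\epsilon$, then there is $x\in C_s$ such that, for a uniformly random vertex $v$, $$\Pr_{v\in X_s(0)}\big[z_v\neq x|_{X_{+(s\cup\{v\})}(k)}\big]\le\rho(\alpha).$$ -/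

import Mathlib

open Polynomial

noncomputable section

namespace HDXCode

/-! ### Linear codes -/

/-- Two linear codes are isomorphic if a bijection of their coordinate sets carries one
onto the other. -/
def CodeIso {F A B : Type*} [Field F] (C : Submodule F (A → F)) (D : Submodule F (B → F)) :
    Prop :=
  ∃ e : A ≃ B, ∀ f : B → F, f ∘ e ∈ C ↔ f ∈ D

/-- The Reed-Solomon code `RS(|F|, d)`: evaluations on all of `F` of the univariate polynomials
of degree at most `d`. -/
def reedSolomon (F : Type*) [Field F] (d : ℕ) : Submodule F (F → F) :=
  (degreeLE F d).map (LinearMap.pi fun a => leval a)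

/-- The tensor code `C ⊗ D`, realized as functions on the product of the coordinate sets. -/
def tensorCode {F A B : Type*} [Field F] (C : Submodule F (A → F)) (D : Submodule F (B → F)) :
    Submodule F (A × B → F) :=
  Submodule.span F {f | ∃ u ∈ C, ∃ v ∈ D, f = fun x => u x.1 * v x.2}

/-- The code `C_{dx, dy}` of all `f : F³ → F` such that `f(x, b, c)` has degree at most `dx` in `x`
and `f(a, y, a y + c)` has degree at most `dy` in `y`, for all `a, b, c`. -/
def vertexCode (F : Type*) [Field F] (dx dy : ℕ) : Submodule F (F × F × F → F) where
  carrier := {f | (∀ b c : F, (fun x => f (x, b, c)) ∈ reedSolomon F dx) ∧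
    ∀ a c : F, (fun y => f (a, y, a * y + c)) ∈ reedSolomon F dy}
  add_mem' hf hg := ⟨fun b c => add_mem (hf.1 b c) (hg.1 b c),
    fun a c => add_mem (hf.2 a c) (hg.2 a c)⟩
  zero_mem' := ⟨fun _ _ => zero_mem _, fun _ _ => zero_mem _⟩
  smul_mem' r _ hf := ⟨fun b c => Submodule.smul_mem _ r (hf.1 b c),
    fun a c => Submodule.smul_mem _ r (hf.2 a c)⟩

/-! ### Codes on simplicial complexes

A simplicial complex is given by its set `X` of faces, including the empty one; a face of
dimension `j` has `j + 1` vertices. -/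

/-- `X(j)`, the faces of dimension `j`. -/
def facesOfDim {V : Type*} (X : Set (Finset V)) (j : ℕ) : Set (Finset V) :=
  {t | t ∈ X ∧ t.card = j + 1}

/-- The star `X_{+s}(j)`: the faces of dimension `j` that contain `s`. -/
def star {V : Type*} (X : Set (Finset V)) (s : Finset V) (j : ℕ) : Set (Finset V) :=
  {t | t ∈ facesOfDim X j ∧ s ⊆ t}

/-- For `s ⊆ t`, the restriction `f|_{X_{+t}(k)}` of a function `f` on `X_{+s}(k)`. -/
def restrict {V F : Type*} {X : Set (Finset V)} {k : ℕ} {s t : Finset V} (h : s ⊆ t)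
    (f : star X s k → F) : star X t k → F :=
  fun u => f ⟨u.1, u.2.1, h.trans u.2.2⟩

/-- Given codes `C t` at the faces `t` of dimension `k - 1` (those with `k` vertices), the code
`C_s = {f : X_{+s}(k) → F | f|_{X_{+t}(k)} ∈ C_t for all t ∈ X_{+s}(k - 1)}` at a face `s`. -/
def localCode {V F : Type*} [Field F] (X : Set (Finset V)) (k : ℕ)
    (C : ∀ t : Finset V, Submodule F (star X t k → F)) (s : Finset V) :
    Submodule F (star X s k → F) where
  carrier := {f | ∀ t ∈ X, t.card = k → ∀ h : s ⊆ t, restrict h f ∈ C t}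
  add_mem' hf hg t ht hk h := add_mem (hf t ht hk h) (hg t ht hk h)
  zero_mem' t _ _ _ := zero_mem (C t)
  smul_mem' r _ hf t ht hk h := Submodule.smul_mem _ r (hf t ht hk h)

/-- Probability of an event for a uniformly random element of a finite type. -/
def prob {A : Type*} (P : A → Prop) : ℝ :=
  (Nat.card {a // P a} : ℝ) / Nat.card A

/-- `(ε, ρ)`-agreement testability of the code `C_s` at a face `s`, seen as a code on the link `X_s`
with the local codes `C_{s ∪ v}`, `v ∈ X_s(0)`.

The vertices of the link correspond to the faces `t ⊇ s` with one more vertex than `s`,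
and the edges of the link to the faces `e ⊇ s` with two more vertices; the end points of `e` are then
the two vertices `t ⊆ e` of the link. -/
def AgreementTestable {V F : Type*} [Field F] (X : Set (Finset V)) (k : ℕ)
    (C : ∀ t : Finset V, Submodule F (star X t k → F)) (s : Finset V) (ε : ℝ) (ρ : ℝ → ℝ) : Prop :=
  0 < ε ∧ StrictMonoOn ρ (Set.Ici 0) ∧ (∀ x, 0 ≤ x → 0 ≤ ρ x) ∧
  ∀ z : (t : star X s s.card) → star X t.1 k → F, (∀ t, z t ∈ C t.1) →
    ∀ α : ℝ, α = prob (fun e : star X s (s.card + 1) =>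
        ∃ (t t' : star X s s.card) (ht : t.1 ⊆ e.1) (ht' : t'.1 ⊆ e.1),
          restrict ht (z t) ≠ restrict ht' (z t')) →
      α < ε →
      ∃ x ∈ C s, prob (fun t : star X s s.card => z t ≠ restrict t.2.2 x) ≤ ρ α

/-! ### Coset complexes -/

/-- The vertices of the coset complex `X[G; (K i)]`: the left cosets of the `K i`, with
their colors `i`. -/
abbrev CosetVertex {G ι : Type*} [Group G] (K : ι → Subgroup G) : Type _ := Σ i, G ⧸ K i

/-- The faces of the coset complex: the finite sets of cosets with a common element. -/
def cosetComplex {G ι : Type*} [Group G] (K : ι → Subgroup G) : Set (Finset (CosetVertex K)) :=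
  {s | ∃ g : G, ∀ v ∈ s, v.2 = (g : G ⧸ K v.1)}

/-- The set of colors of a set of vertices. -/
def color {G ι : Type*} [Group G] [DecidableEq ι] {K : ι → Subgroup G}
    (s : Finset (CosetVertex K)) : Finset ι :=
  s.image Sigma.fst

/-- The top-dimensional face of the coset complex given by the cosets `g K i`, for all `i`. -/
def topFace {G ι : Type*} [Group G] [Fintype ι] (K : ι → Subgroup G) (g : G) :
    Finset (CosetVertex K) :=
  Finset.univ.map ⟨fun i => ⟨i, (g : G ⧸ K i)⟩, fun _ _ h => congrArg Sigma.fst h⟩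

theorem mem_topFace {G ι : Type*} [Group G] [Fintype ι] {K : ι → Subgroup G} {g : G}
    {v : CosetVertex K} : v ∈ topFace K g ↔ v.2 = (g : G ⧸ K v.1) := by
  obtain ⟨i, x⟩ := v
  simp only [topFace, Finset.mem_map, Finset.mem_univ, true_and]
  constructor
  · rintro ⟨j, h⟩
    obtain ⟨rfl, h⟩ := Sigma.mk.inj_iff.1 h
    exact (eq_of_heq h).symm
  · rintro h
    exact ⟨i, by rw [h]; rfl⟩

/-! ### The `k`-dimensional complex and its codes -/

/-- A polynomial `φ` over a field is primitive if it is irreducible and the class of the variable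
generates the multiplicative group of `F[t]/(φ)`. -/
def IsPrimitivePolynomial {F : Type*} [Field F] (φ : F[X]) : Prop :=
  Irreducible φ ∧ ∃ u : (AdjoinRoot φ)ˣ, (u : AdjoinRoot φ) = AdjoinRoot.root φ ∧
    ∀ v : (AdjoinRoot φ)ˣ, v ∈ Subgroup.zpowers u

theorem ne_succ {k : ℕ} [NeZero k] (i : Fin (k + 1)) : i ≠ i + 1 := by
  have := NeZero.pos k
  intro h
  have h1 : (1 : Fin (k + 1)) = 0 := by simpa using h.symm
  rw [Fin.ext_iff, Fin.val_one', Fin.val_zero, Nat.mod_eq_of_lt (by omega)] at h1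
  omega

/-- The matrix `h_i(a) = I + e_{i,i+1}(a t)` over `R = F[t]/(φ)`, with the row and column indices
taken modulo `k + 1`. -/
def elemMatrix {F : Type*} [Field F] (φ : F[X]) (k : ℕ) [NeZero k] (i : Fin (k + 1)) (a : F) :
    Matrix.SpecialLinearGroup (Fin (k + 1)) (AdjoinRoot φ) :=
  Matrix.SpecialLinearGroup.transvection (ne_succ i) (AdjoinRoot.of φ a * AdjoinRoot.root φ)

/-- The group `G` generated by all `h_i(a)`. -/
abbrev grp {F : Type*} [Field F] (φ : F[X]) (k : ℕ) [NeZero k] :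
    Subgroup (Matrix.SpecialLinearGroup (Fin (k + 1)) (AdjoinRoot φ)) :=
  Subgroup.closure {x | ∃ i a, x = elemMatrix φ k i a}

/-- `h_i(a)` as an element of `G`. -/
def h {F : Type*} [Field F] (φ : F[X]) (k : ℕ) [NeZero k] (i : Fin (k + 1)) (a : F) : grp φ k :=
  ⟨elemMatrix φ k i a, Subgroup.subset_closure ⟨i, a, rfl⟩⟩

/-- The subgroup `K_i` of `G` generated by the `h_j(a)` with `j ≠ i`. -/
def K {F : Type*} [Field F] (φ : F[X]) (k : ℕ) [NeZero k] (i : Fin (k + 1)) :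
    Subgroup (grp φ k) :=
  Subgroup.closure {x | ∃ j a, j ≠ i ∧ x = h φ k j a}

/-- The `k`-dimensional complex `X[G; K_1, …, K_{k+1}]`. -/
abbrev complex {F : Type*} [Field F] (φ : F[X]) (k : ℕ) [NeZero k] :
    Set (Finset (CosetVertex (K φ k))) :=
  cosetComplex (K φ k)

/-- If `g` lies in all cosets in `t` and `i` is not a color of `t`, then so does `g h_i(a)`. -/
theorem topFace_mem_star {F : Type*} [Field F] {φ : F[X]} {k : ℕ} [NeZero k]
    {t : Finset (CosetVertex (K φ k))} {g : grp φ k} {i : Fin (k + 1)} (hi : i ∉ color t)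
    (hg : t ⊆ topFace (K φ k) g) (a : F) :
    topFace (K φ k) (g * h φ k i a) ∈ star (complex φ k) t k := by
  refine ⟨⟨⟨g * h φ k i a, fun v hv => mem_topFace.1 hv⟩, by simp [topFace]⟩, fun v hv => ?_⟩
  rw [mem_topFace, mem_topFace.1 (hg hv), QuotientGroup.eq, inv_mul_cancel_left]
  refine Subgroup.subset_closure ⟨i, a, ?_, rfl⟩
  rintro rfl
  exact hi (Finset.mem_image_of_mem _ hv)

/-- The code `C_t` at a face `t` of dimension `k - 1`, with missing color `i`. The `k`-faces
containing `t` are those given by the elements `g h_i(a)`, `a ∈ F`, of a coset of `H_i`, and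
`f` is a codeword if `f(g h_i(a))` is a Reed-Solomon codeword of degree `d` as a function of `a`. -/
def edgeCode {F : Type*} [Field F] (φ : F[X]) (k : ℕ) [NeZero k] (d : ℕ)
    (t : Finset (CosetVertex (K φ k))) : Submodule F (star (complex φ k) t k → F) where
  carrier := {f | ∀ (i : Fin (k + 1)) (hi : i ∉ color t) (g : grp φ k)
    (hg : t ⊆ topFace (K φ k) g),
      (fun a : F => f ⟨topFace (K φ k) (g * h φ k i a), topFace_mem_star hi hg a⟩) ∈
        reedSolomon F d}
  add_mem' hf hf' i hi g hg := add_mem (hf i hi g hg) (hf' i hi g hg)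
  zero_mem' _ _ _ _ := zero_mem _
  smul_mem' r _ hf i hi g hg := Submodule.smul_mem _ r (hf i hi g hg)

/-- The code `C_s` at a face `s` of the complex, with degree parameter `d`. -/
def faceCode {F : Type*} [Field F] (φ : F[X]) (k : ℕ) [NeZero k] (d : ℕ)
    (s : Finset (CosetVertex (K φ k))) : Submodule F (star (complex φ k) s k → F) :=
  localCode (complex φ k) k (edgeCode φ k d) s

end HDXCode

end

/-! Geometry. In the cyclic order of indices that ends at `c`, the elements of `K φ k c` are
unipotent upper triangular matrices whose entries are scalars times the power of `t` given by the
distance to the diagonal (`isBand_of_mem_K`). Combining this for all `c ≠ i, j` identifies the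
intersection of these groups: it is a Heisenberg group over `F` if `i` and `j` are adjacent, and `F
× F` otherwise. The top faces above `s` form a coset of it. The link is bipartite, its vertices
being the orbits of `H_i` and of `H_j`; `LinkChart` records the coordinates. In Heisenberg
coordinates the orbits are the lines `(x, b, c)` and `(a, y, a y + c)`, which yields `C_{d,d}`; in
the other case they are the rows and columns of a square, which yields the tensor code.

Agreement. The local codewords glue to two functions `P` and `Q`, of degree at most `d` on the lines
of the first and of the second family respectively, and `α` is the fraction of points where they
differ. Put `β = α^{1/3} q`. Counting monomials produces a nonzero polynomial `E`, of degree at most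
`β` along the first family and `3β/2` along the second, that vanishes wherever `P ≠ Q`. So `E P = E
Q` is a codeword for larger degrees. By `exists_poly_of_mem_vertexCode` it is given by a polynomial
`N` obeying the degree bounds formally, and `E` divides `N` on every line. A resultant argument in
the style of Polishchuk and Spielman (`natDegree_eq_zero_of_isRelPrime`, `dvd_of_dvd_on_lines`)
upgrades this to `E ∣ N`. The quotient is the desired codeword: it agrees with `P` or `Q` on each
line where `E` is not identically zero, and `card_onXLine_eq_zero_le` bounds the number of other
lines.

The argument treats the two families symmetrically through the involution `flip`. The divisibility
step needs `2 (β + 3β/2) + 4 d < q`, which is the threshold `ε`. At most `(β + 2 · 3β/2) q = 4 β q`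
lines of each family are lost, which is `ρ`. The tensor code is handled by the same theorem, with
`P`, `Q` and `E` constant in `z`. -/

namespace HDXCode

/-! ### Polynomials in `x, y, z` and the involution exchanging the two families of lines -/

section Trivariate

variable {F : Type*} [Field F]

/-- Evaluation at `(x, y, z)` of a polynomial in `F[y][z][x]`. -/
noncomputable def eval3 (x y z : F) : F[X][X][X] →+* F :=
  eval₂RingHom (eval₂RingHom (evalRingHom y) z) x

theorem ringHom_ext₃ {R : Type*} [Semiring R] {φ ψ : F[X][X][X] →+* R}
    (h : ∀ a, φ (C (C (C a))) = ψ (C (C (C a)))) (hy : φ (C (C X)) = ψ (C (C X)))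
    (hz : φ (C X) = ψ (C X)) (hx : φ X = ψ X) : φ = ψ :=
  ringHom_ext' (ringHom_ext' (ringHom_ext' (RingHom.ext h) hy) hz) hx

/-- The involution `f(x, y, z) ↦ f(y, x, x y - z)` of `F[y][z][x]`. It exchanges the two families
of lines defining `vertexCode`. -/
noncomputable def flip : F[X][X][X] →+* F[X][X][X] :=
  eval₂RingHom (S := F[X][X][X]) (eval₂RingHom (S := F[X][X][X])
    (eval₂RingHom (S := F[X][X][X]) (C.comp (C.comp C)) X) (X * C (C X) - C X)) (C (C X))

theorem flip_C_C_C (a : F) : flip (C (C (C a))) = C (C (C a)) := by simp [flip]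

theorem flip_y : flip (C (C X) : F[X][X][X]) = X := by simp [flip]

theorem flip_z : flip (C X : F[X][X][X]) = X * C (C X) - C X := by simp [flip]

theorem flip_x : flip (X : F[X][X][X]) = C (C X) := by simp [flip]

theorem flip_sub (f g : F[X][X][X]) : flip (f - g) = flip f - flip g := map_sub flip f g

theorem flip_flip (f : F[X][X][X]) : flip (flip f) = f := by
  have : (flip.comp flip : F[X][X][X] →+* F[X][X][X]) = RingHom.id _ := by
    apply ringHom_ext₃ <;> intros <;>
      simp only [RingHom.comp_apply, RingHom.id_apply, flip_C_C_C, flip_x,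
        flip_y, flip_z]
    rw [flip_sub, RingHom.map_mul, flip_x, flip_y, flip_z]
    ring
  exact congrArg (fun φ => φ f) this

theorem flip_injective : Function.Injective (flip : F[X][X][X] →+* F[X][X][X]) :=
  Function.LeftInverse.injective flip_flip

theorem eval3_flip (x y z : F) (f : F[X][X][X]) :
    eval3 x y z (flip f) = eval3 y x (x * y - z) f := by
  have : (eval3 x y z).comp flip = eval3 y x (x * y - z) := by
    apply ringHom_ext₃ <;> intros <;>
      simp [flip_C_C_C, flip_x, flip_y, flip_z, eval3, mul_comm]
  exact congrArg (fun φ => φ f) this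

theorem coeff_coeff_swap {R : Type*} [CommRing R] (f : R[X][X]) (m n : ℕ) :
    ((Bivariate.swap f).coeff m).coeff n = (f.coeff n).coeff m := by
  induction f using Polynomial.induction_on' with
  | add p q hp hq => simp [hp, hq]
  | monomial i a =>
    induction a using Polynomial.induction_on' with
    | add p q hp hq => simp only [map_add, coeff_add, hp, hq]
    | monomial j r =>
      rw [Bivariate.swap_monomial_monomial]
      simp only [coeff_monomial]
      split_ifs <;> simp [coeff_monomial, *]

/-- The degree in the inner variable. -/
noncomputable def innerDegree {R : Type*} [CommRing R] (f : R[X][X]) : ℕ :=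
  (Bivariate.swap f).natDegree

theorem natDegree_coeff_le_innerDegree {R : Type*} [CommRing R] (f : R[X][X]) (i : ℕ) :
    (f.coeff i).natDegree ≤ innerDegree f := by
  rw [natDegree_le_iff_coeff_eq_zero]
  intro N hN
  rw [← coeff_coeff_swap, coeff_eq_zero_of_natDegree_lt hN, coeff_zero]

theorem innerDegree_le_iff {R : Type*} [CommRing R] {f : R[X][X]} {n : ℕ} :
    innerDegree f ≤ n ↔ ∀ i, (f.coeff i).natDegree ≤ n := by
  refine ⟨fun h i => (natDegree_coeff_le_innerDegree f i).trans h, fun h => ?_⟩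
  rw [innerDegree, natDegree_le_iff_coeff_eq_zero]
  intro N hN
  ext i
  rw [coeff_coeff_swap, coeff_eq_zero_of_natDegree_lt ((h i).trans_lt hN), coeff_zero]

theorem innerDegree_mul {R : Type*} [CommRing R] [IsDomain R] {f g : R[X][X]}
    (hf : f ≠ 0) (hg : g ≠ 0) : innerDegree (f * g) = innerDegree f + innerDegree g := by
  rw [innerDegree, map_mul, natDegree_mul (by simpa using hf) (by simpa using hg)]
  rfl

/-- With `z` as the outer variable, `flip` exchanges `x` and `y` in the coefficients and then
substitutes `x y - z`, which is linear in `z`. -/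
theorem innerDegree_flip_le (f : F[X][X][X]) : innerDegree (flip f) ≤ innerDegree f := by
  let τ : F[X][X][X] →+* F[X][X][X] :=
    (compRingHom (C (X * C X) - X)).comp (mapRingHom Bivariate.swap.toRingHom)
  have h : Bivariate.swap.toRingHom.comp flip = τ.comp Bivariate.swap.toRingHom := by
    apply ringHom_ext₃ <;> intros <;>
      simp [τ, flip_C_C_C, flip_x, flip_y, flip_z, Bivariate.swap_Y, Bivariate.swap_C]
    refine (map_sub (Bivariate.swap (R := F[X])) _ _).trans ?_
    rw [map_mul Bivariate.swap, Bivariate.swap_Y, Bivariate.swap_C,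
      Bivariate.swap_C, map_X, map_C]
  have h' : Bivariate.swap (flip f) = τ (Bivariate.swap f) := congrArg (fun φ => φ f) h
  rw [innerDegree, h']
  refine natDegree_comp_le.trans ?_
  have h1 : (C (X * C X) - X : F[X][X][X]).natDegree ≤ 1 := by compute_degree
  calc _ ≤ (Bivariate.swap f).natDegree * 1 := Nat.mul_le_mul natDegree_map_le h1
    _ = _ := by rw [mul_one]; rfl

/-- Restriction to the plane `z = u y + w`. -/
noncomputable def onLine (u w : F) : F[X][X][X] →+* F[X][X] :=
  mapRingHom (evalRingHom (C u * X + C w))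

/-- If `f` has degree `≤ a` in `x` and `f(x, y, x y + c)` has degree `≤ b` in `y`, then
`f(x, y, u y + w)` has degree `≤ a + b` in `y`. -/
theorem innerDegree_onLine_le (u w : F) (f : F[X][X][X]) :
    innerDegree (onLine u w f) ≤ f.natDegree + (flip f).natDegree := by
  let ψ : F[X][X] →+* F[X][X] := (compRingHom (C X * X)).comp
    ((compRingHom (X - C (C w))).comp (mapRingHom (compRingHom (X + C u))))
  let Ψ : F[X][X][X] →+* F[X][X] := eval₂RingHom ψ X
  -- Shift `x` by `u`. Since `f(x, y, z)` is `flip f` at `(y, x, x y - z)`, the value `f(x + u, y, u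
  -- y + w)` is `flip f` at `(y, x + u, x y - w)`: in the last two slots `y` occurs only through the
  -- product `x y`.
  have key : (mapRingHom (compRingHom (X + C u))).comp
      (Bivariate.swap.toRingHom.comp (onLine u w)) = Ψ.comp flip := by
    apply ringHom_ext₃ <;> intros <;>
      simp [ψ, Ψ, onLine, flip_C_C_C, flip_x, flip_y, flip_z, Bivariate.swap_Y,
        Bivariate.swap_C]
    ring
  have key' : (Bivariate.swap (onLine u w f)).map (compRingHom (X + C u)) = Ψ (flip f) :=
    congrArg (fun φ => φ f) key
  rw [innerDegree, natDegree_le_iff_coeff_eq_zero]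
  intro N hN
  -- At most `(flip f).natDegree` factors `y` come from the first slot; each of the others carries a
  -- factor `x`. For large `N` this contradicts the bound on the degree in `x`.
  have hdvd : (X : F[X]) ^ (N - (flip f).natDegree) ∣ (Ψ (flip f)).coeff N := by
    have : Ψ (flip f) = (flip f).sum fun i a => ψ a * X ^ i := eval₂_eq_sum
    rw [this, Polynomial.sum, finsetSum_coeff]
    refine Finset.dvd_sum fun i hi => ?_
    rw [coeff_mul_X_pow']
    split_ifs with hiN
    · have hi' := le_natDegree_of_mem_supp i hi
      have : ψ ((flip f).coeff i) = ((((flip f).coeff i).map (compRingHom (X + C u))).comp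
        (X - C (C w))).comp (C X * X) := rfl
      rw [this, comp_C_mul_X_coeff]
      exact Dvd.dvd.mul_left (pow_dvd_pow _ (by omega)) _
    · exact dvd_zero _
  have hdeg : ((Ψ (flip f)).coeff N).natDegree ≤ f.natDegree := by
    rw [← key', coeff_map]
    refine (natDegree_comp_le (p := (Bivariate.swap (onLine u w f)).coeff N)
      (q := X + C u)).trans ?_
    rw [natDegree_X_add_C, mul_one, natDegree_le_iff_coeff_eq_zero]
    intro M hM
    rw [coeff_coeff_swap, onLine, coe_mapRingHom, coeff_map, coeff_eq_zero_of_natDegree_lt hM,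
      map_zero, coeff_zero]
  have h0 : (Ψ (flip f)).coeff N = 0 := by
    by_contra hne
    have := natDegree_le_of_dvd hdvd hne
    rw [natDegree_X_pow] at this
    omega
  rw [← key', coeff_map] at h0
  exact (comp_X_add_C_eq_zero_iff (t := u)).1 h0

end Trivariate
-- Resultants: nonvanishing, degree and order of vanishing
section Resultant

/-- A kernel vector of the Sylvester matrix is a relation `f v + g u = 0` with `deg u < deg f`.
Relative primality forces `f ∣ u`, hence `u = 0` and then `v = 0`. -/
theorem resultant_ne_zero_of_isRelPrime {R : Type*} [CommRing R] [IsDomain R]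
    [UniqueFactorizationMonoid R] {f g : R[X]} {n : ℕ} (h : IsRelPrime f g) (hf : f ≠ 0)
    (hg : g.natDegree ≤ n) : f.resultant g f.natDegree n ≠ 0 := by
  intro h0
  obtain ⟨v, hv, hv0⟩ := Matrix.exists_mulVec_eq_zero_iff.2 h0
  let b := (degreeLT.basis R f.natDegree).prod (degreeLT.basis R n)
  let x := b.equivFun.symm (v ∘ finSumFinEquiv)
  have hx : ⇑(b.repr x) = v ∘ finSumFinEquiv := by
    rw [← b.equivFun_apply]; exact b.equivFun.apply_symm_apply _
  have hx0 : x ≠ 0 := by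
    intro hx0
    apply hv
    have : v ∘ finSumFinEquiv = 0 := by rw [← hx, hx0]; simp
    ext i
    simpa using congrFun this (finSumFinEquiv.symm i)
  have hmap : sylvesterMap f g le_rfl hg x = 0 := by
    have h1 := LinearMap.toMatrix_mulVec_repr b (degreeLT.basis R (f.natDegree + n))
      (sylvesterMap f g le_rfl hg) x
    rw [toMatrix_sylvesterMap, hx, Matrix.reindex_apply, Matrix.submatrix_mulVec_equiv] at h1
    simp only [Equiv.symm_symm, Equiv.refl_symm, Equiv.coe_refl, Function.comp_id,
      Function.comp_assoc, Equiv.self_comp_symm, hv0] at h1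
    have h2 : (degreeLT.basis R (f.natDegree + n)).repr (sylvesterMap f g le_rfl hg x) = 0 := by
      ext i; exact (congrFun h1 i).symm
    simpa using h2
  have hmap' : f * x.2 + g * x.1 = (0 : R[X]) := congrArg Subtype.val hmap
  have hdvd : f ∣ (x.1 : R[X]) :=
    h.dvd_of_dvd_mul_left ⟨-x.2, by linear_combination hmap'⟩
  have hx1 : (x.1 : R[X]) = 0 := by
    by_contra hne
    have := degree_le_of_dvd hdvd hne
    have h2 := mem_degreeLT.1 x.1.2
    rw [degree_eq_natDegree hf] at this
    exact absurd h2 (not_lt.2 this)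
  rw [hx1, mul_zero, add_zero, mul_eq_zero, or_iff_right hf] at hmap'
  exact hx0 (Prod.ext (Subtype.ext hx1) (Subtype.ext hmap'))

theorem natDegree_det_le {ι R : Type*} [Fintype ι] [DecidableEq ι] [CommRing R]
    (M : Matrix ι ι R[X]) (w : ι → ℕ) (h : ∀ i j, (M i j).natDegree ≤ w j) :
    M.det.natDegree ≤ ∑ j, w j := by
  rw [Matrix.det_apply]
  refine natDegree_sum_le_of_forall_le _ _ fun σ _ => ?_
  refine (natDegree_smul_le _ _).trans ((natDegree_prod_le _ _).trans ?_)
  exact Finset.sum_le_sum fun j _ => h _ j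

theorem natDegree_resultant_le {R : Type*} [CommRing R] (f g : R[X][X]) (m n : ℕ) :
    (f.resultant g m n).natDegree ≤ m * innerDegree g + n * innerDegree f := by
  refine (natDegree_det_le _ (Fin.addCases (fun _ => innerDegree g) fun _ => innerDegree f)
    fun i j => ?_).trans_eq ?_
  · simp only [sylvester, Matrix.of_apply]
    induction j using Fin.addCases with
    | left j =>
      simp only [Fin.addCases_left]
      split_ifs
      · exact natDegree_coeff_le_innerDegree _ _
      · simp
    | right j =>
      simp only [Fin.addCases_right]
      split_ifs
      · exact natDegree_coeff_le_innerDegree _ _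
      · simp
  · rw [Fin.sum_univ_add]
    simp

/-- If `g ≡ f q` modulo `X - c` with `q` of degree at most `n - m`, then the resultant of `f`
and `g` vanishes at `c` to order `m`. -/
theorem X_sub_C_pow_dvd_resultant {F : Type*} [Field F] {f g : F[X][X]} {m d : ℕ}
    (hf : f.natDegree ≤ m) {c : F} {q : F[X]} (hq : q.natDegree ≤ d)
    (h : g.map (evalRingHom c) = f.map (evalRingHom c) * q) :
    (X - C c) ^ m ∣ f.resultant g m (m + d) := by
  have hr : ∀ i, X - C c ∣ (g - f * q.map C).coeff i := by
    intro i
    rw [dvd_iff_isRoot, IsRoot, ← coe_evalRingHom, ← coeff_map, Polynomial.map_sub,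
      Polynomial.map_mul, h, map_map]
    have : (evalRingHom c).comp C = RingHom.id F := by ext; simp
    rw [this, map_id, sub_self, coeff_zero]
  obtain ⟨r, hr⟩ := C_dvd_iff_dvd_coeff _ _ |>.2 hr
  -- The multiple of `f` does not change the resultant, and the scalar `X - c` comes out once for
  -- each of the `m` columns of `g`.
  have hg : g = C (X - C c) * r + f * q.map C := by rw [← hr]; ring
  rw [hg, resultant_add_mul_right _ _ _ _ _ (by rw [natDegree_map]; omega) hf,
    resultant_C_mul_right]
  exact Dvd.intro _ rfl

end Resultant

/-! ### From divisibility on lines to divisibility of polynomials -/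

section Divisibility

variable {F : Type*} [Field F]

/-- The restriction of `f` to the line of all `(x, y, z)` with given `y` and `z`. -/
noncomputable def onXLine (y z : F) : F[X][X][X] →+* F[X] :=
  mapRingHom (eval₂RingHom (evalRingHom y) z)

theorem onXLine_eq (u w y : F) (f : F[X][X][X]) :
    onXLine y (u * y + w) f = (onLine u w f).map (evalRingHom y) := by
  have : (onXLine y (u * y + w)) = (mapRingHom (evalRingHom y)).comp (onLine u w) := by
    apply ringHom_ext₃ <;> intros <;> simp [onXLine, onLine]
  exact congrArg (fun φ => φ f) this

theorem eval_onXLine (x y z : F) (f : F[X][X][X]) :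
    (onXLine y z f).eval x = eval3 x y z f := by
  have : (evalRingHom x).comp (onXLine y z) = eval3 x y z := by
    apply ringHom_ext₃ <;> intros <;> simp [onXLine, eval3]
  exact congrArg (fun φ => φ f) this

theorem natDegree_onXLine_le (y z : F) (f : F[X][X][X]) :
    (onXLine y z f).natDegree ≤ f.natDegree := natDegree_map_le

theorem natDegree_onLine_le (u w : F) (f : F[X][X][X]) :
    (onLine u w f).natDegree ≤ f.natDegree := natDegree_map_le

variable [Fintype F]

/-- A nonzero polynomial in `F[y][z]` of degree less than `|F|²` in `z` does not vanish on every
line `z = u y + w`. -/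
theorem exists_line_eval_ne_zero {f : F[X][X]} (hf : f ≠ 0)
    (hdeg : f.natDegree < Fintype.card F ^ 2) : ∃ u w : F, f.eval (C u * X + C w) ≠ 0 := by
  by_contra! h
  refine hf (eq_zero_of_natDegree_lt_card_of_eval_eq_zero f
    (f := fun a : F × F => C a.1 * X + C a.2) ?_ (fun a => h a.1 a.2) ?_)
  · rintro ⟨u, w⟩ ⟨u', w'⟩ he
    have h1 := congrArg (coeff · 1) he
    have h0 := congrArg (coeff · 0) he
    simp at h1 h0
    rw [h1, h0]
  · rwa [Fintype.card_prod, ← sq]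

/-- The resultant of `e` and `n` in `x` is a nonzero polynomial in `y, z`. On a suitable line `z = u
y + w` it has small degree in `y` by `innerDegree_onLine_le`, yet it vanishes to order `deg e` at
every `y` where `e` divides `n` on the `x`-line. This is impossible unless `deg e = 0`. Here `G` is
the common factor removed beforehand; nothing is known on the lines where it vanishes. -/
theorem natDegree_eq_zero_of_isRelPrime {e n G : F[X][X][X]} {d z : ℕ} (he : e ≠ 0) (hG : G ≠ 0)
    (hrel : IsRelPrime e n) (hn : n.natDegree ≤ e.natDegree + d)
    (hn' : (flip n).natDegree ≤ (flip e).natDegree + d)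
    (hle : (flip e).natDegree ≤ e.natDegree)
    (hez : innerDegree e ≤ z) (hnz : innerDegree n ≤ z) (hGz : innerDegree G ≤ z)
    (hz : 2 * z < Fintype.card F)
    (hcard : 2 * (e.natDegree + (flip e).natDegree) + 2 * (G.natDegree + (flip G).natDegree) + 4 * d
      < Fintype.card F)
    (hdiv : ∀ y z : F, onXLine y z G ≠ 0 →
      ∃ q : F[X], q.natDegree ≤ d ∧ onXLine y z n = onXLine y z e * q) :
    e.natDegree = 0 := by
  by_contra ha
  set a := e.natDegree with ha_def
  set b := (flip e).natDegree with hb_def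
  set R := e.resultant n a (a + d) with hR_def
  have hR : R ≠ 0 := resultant_ne_zero_of_isRelPrime hrel he hn
  have hg : G.leadingCoeff ≠ 0 := by simpa using hG
  have hRdeg : R.natDegree ≤ a * z + (a + d) * z :=
    (natDegree_resultant_le _ _ _ _).trans (by gcongr)
  have hgdeg : G.leadingCoeff.natDegree ≤ z := (natDegree_coeff_le_innerDegree _ _).trans hGz
  -- The leading coefficient of `G` must survive on the line too, so that `G` vanishes on few of its
  -- `x`-lines.
  obtain ⟨u, w, huw⟩ := exists_line_eval_ne_zero (mul_ne_zero hR hg) (by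
    rw [natDegree_mul hR hg]
    have : 2 * a + d + 1 ≤ Fintype.card F := by omega
    nlinarith)
  rw [eval_mul, mul_ne_zero_iff] at huw
  set g₁ := G.leadingCoeff.eval (C u * X + C w) with hg₁
  have hR₁ : R.eval (C u * X + C w) = (onLine u w e).resultant (onLine u w n) a (a + d) := by
    rw [onLine, coe_mapRingHom, resultant_map_map]; rfl
  set R₁ := R.eval (C u * X + C w)
  have hR₁deg : R₁.natDegree ≤ a * (a + d + (b + d)) + (a + d) * (a + b) := by
    rw [hR₁]
    refine (natDegree_resultant_le _ _ _ _).trans ?_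
    gcongr
    · exact (innerDegree_onLine_le u w n).trans (by omega)
    · exact innerDegree_onLine_le u w e
  have hg₁deg : g₁.natDegree ≤ G.natDegree + (flip G).natDegree := by
    refine le_trans (le_trans (le_of_eq ?_) (natDegree_coeff_le_innerDegree (onLine u w G)
      G.natDegree)) (innerDegree_onLine_le u w G)
    rw [onLine, coe_mapRingHom, coeff_map]; rfl
  -- The factor `g₁ ^ a` supplies the order `a` at the exceptional `y`, so the product can run over
  -- all of `F`.
  have hprod : ∏ y : F, (X - C y) ^ a ∣ R₁ * g₁ ^ a := by
    refine Finset.prod_dvd_of_coprime (fun y _ y' _ hyy' => ?_) fun y _ => ?_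
    · exact (pairwise_coprime_X_sub_C Function.injective_id hyy').pow
    · by_cases hy : g₁.eval y = 0
      · exact Dvd.dvd.mul_left (pow_dvd_pow_of_dvd (dvd_iff_isRoot.2 hy) a) _
      · obtain ⟨q, hq, hq'⟩ := hdiv y (u * y + w) (by
          intro h0
          apply hy
          have := congrArg (coeff · G.natDegree) h0
          rw [onXLine_eq] at this
          simpa [onLine] using this)
        rw [onXLine_eq, onXLine_eq] at hq'
        rw [hR₁]
        exact Dvd.dvd.mul_right
          (X_sub_C_pow_dvd_resultant (natDegree_onLine_le u w e) hq hq') _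
  have hdeg := natDegree_le_of_dvd hprod (mul_ne_zero huw.1 (pow_ne_zero _ huw.2))
  rw [natDegree_mul huw.1 (pow_ne_zero _ huw.2), natDegree_pow,
    natDegree_prod _ _ (fun y _ => pow_ne_zero _ (X_sub_C_ne_zero y))] at hdeg
  simp only [natDegree_pow, natDegree_X_sub_C, mul_one, Finset.sum_const, Finset.card_univ,
    smul_eq_mul] at hdeg
  have ha' : 0 < a := Nat.pos_of_ne_zero ha
  have h1 : Fintype.card F * a ≤
      a * (a + d + (b + d)) + (a + d) * (a + b) + a * (G.natDegree + (flip G).natDegree) :=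
    hdeg.trans (by gcongr)
  -- Here `b ≤ a` is essential: `d (a + b) ≤ 2 a d` makes the whole bound divisible by `a`.
  have h2 : (a + d) * (a + b) ≤ a * (a + b + 2 * d) := by nlinarith
  have h3 : Fintype.card F * a ≤ a * ((a + d + (b + d)) + (a + b + 2 * d) +
      (G.natDegree + (flip G).natDegree)) := by linarith
  rw [mul_comm] at h3
  have := Nat.le_of_mul_le_mul_left h3 ha'
  omega

end Divisibility
-- Removal of common factors
section Divisibility

variable {F : Type*} [Field F]

/-- If `e = k(y, z)` and `flip e = k(x, x y - z)` does not involve `x`, then `x = 0` gives `flip e =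
r(z)` with `r(z) = k(0, -z)`. Hence `e = r(x y - z)`, and independence of `x` makes `r` constant. -/
theorem isUnit_of_natDegree_eq_zero {e : F[X][X][X]} (he : e ≠ 0) (h : e.natDegree = 0)
    (h' : (flip e).natDegree = 0) : IsUnit e := by
  obtain ⟨k, hk⟩ := natDegree_eq_zero.1 h
  obtain ⟨k', hk'⟩ := natDegree_eq_zero.1 h'
  have hA : ∀ r : F[X][X],
      (flip (C r)).eval 0 = ((r.map (evalRingHom 0)).comp (-X)).map C := by
    have : ((evalRingHom 0).comp (flip.comp C) : F[X][X] →+* F[X][X]) =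
        (mapRingHom C).comp ((compRingHom (-X)).comp (mapRingHom (evalRingHom 0))) := by
      refine ringHom_ext' (ringHom_ext' (RingHom.ext fun a => ?_) ?_) ?_ <;>
        simp [flip_C_C_C, flip_y, flip_z]
    exact fun r => congrArg (fun φ => φ r) this
  have hB : ∀ r : F[X], ((flip (C (r.map C))).eval 1).eval 0 = r := by
    have : ((evalRingHom 0).comp ((evalRingHom 1).comp (flip.comp (C.comp (mapRingHom C)))) :
        F[X] →+* F[X]) = RingHom.id _ := by
      refine ringHom_ext' (RingHom.ext fun a => ?_) ?_ <;>
        simp [flip_C_C_C, flip_z]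
    exact fun r => congrArg (fun φ => φ r) this
  have hD : ∀ r : F[X], ((flip (C (r.map C))).eval 0).eval 0 = C (r.eval 0) := by
    have : ((evalRingHom 0).comp ((evalRingHom 0).comp (flip.comp (C.comp (mapRingHom C)))) :
        F[X] →+* F[X]) = C.comp (evalRingHom 0) := by
      refine ringHom_ext' (RingHom.ext fun a => ?_) ?_ <;>
        simp [flip_C_C_C, flip_z]
    exact fun r => congrArg (fun φ => φ r) this
  set r := (k.map (evalRingHom 0)).comp (-X) with hr
  have h1 : k' = r.map C := by
    rw [hr, ← hA, hk, ← hk', eval_C]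
  have h2 : flip (C (r.map C)) = C k := by rw [← h1, hk', flip_flip, hk]
  have h3 : r = C (r.eval 0) := by
    rw [← hD, h2, eval_C, ← hB r, h2, eval_C]
  have h4 : e = C (C (C (r.eval 0))) := by
    rw [← flip_flip e, ← hk', h1, h3, Polynomial.map_C, flip_C_C_C]
    simp
  rw [h4]
  have : r.eval 0 ≠ 0 := by
    intro h0
    rw [h4, h0] at he
    simp at he
  exact (((isUnit_iff_ne_zero.2 this).map C).map C).map C

theorem isRelPrime_flip {e n : F[X][X][X]} (h : IsRelPrime e n) :
    IsRelPrime (flip e) (flip n) := by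
  intro c hc hc'
  have hd : ∀ f : F[X][X][X], c ∣ flip f → flip c ∣ f := by
    rintro f ⟨v, hv⟩
    exact ⟨flip v, by rw [← RingHom.map_mul, ← hv, flip_flip]⟩
  rw [← flip_flip c]
  exact (h (hd e hc) (hd n hc')).map flip

variable [Fintype F]

/-- A polynomial divisible by `E` on all lines of both families is divisible by `E`. -/
theorem dvd_of_dvd_on_lines {E N : F[X][X][X]} {d z : ℕ} (hE : E ≠ 0)
    (hN : N.natDegree ≤ E.natDegree + d)
    (hN' : (flip N).natDegree ≤ (flip E).natDegree + d)
    (hEz : innerDegree E ≤ z) (hNz : innerDegree N ≤ z)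
    (hz : 2 * z < Fintype.card F)
    (hcard : 2 * (E.natDegree + (flip E).natDegree) + 4 * d < Fintype.card F)
    (hx : ∀ y z : F, ∃ q : F[X], q.natDegree ≤ d ∧ onXLine y z N = onXLine y z E * q)
    (hy : ∀ y z : F, ∃ q : F[X], q.natDegree ≤ d ∧
      onXLine y z (flip N) = onXLine y z (flip E) * q) : E ∣ N := by
  obtain rfl | hN0 := eq_or_ne N 0
  · exact dvd_zero _
  obtain ⟨n, e, G, hrel, rfl, rfl⟩ := UniqueFactorizationMonoid.exists_reduced_factors' N E hE
  have hG : G ≠ 0 := left_ne_zero_of_mul hE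
  have he : e ≠ 0 := right_ne_zero_of_mul hE
  have hn : n ≠ 0 := right_ne_zero_of_mul hN0
  have hfl : ∀ {f : F[X][X][X]}, f ≠ 0 → flip f ≠ 0 := fun hf h =>
    hf (flip_injective (h.trans (map_zero flip).symm))
  rw [natDegree_mul hG he, natDegree_mul hG hn] at hN
  rw [map_mul, map_mul, natDegree_mul (hfl hG) (hfl he), natDegree_mul (hfl hG) (hfl hn)] at hN'
  rw [innerDegree_mul hG he] at hEz
  rw [innerDegree_mul hG hn] at hNz
  rw [map_mul, natDegree_mul (hfl hG) (hfl he), natDegree_mul hG he] at hcard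
  have hcancel : ∀ {G e n : F[X][X][X]}, (∀ y z : F, ∃ q : F[X], q.natDegree ≤ d ∧
      onXLine y z (G * n) = onXLine y z (G * e) * q) → ∀ y z : F, onXLine y z G ≠ 0 →
      ∃ q : F[X], q.natDegree ≤ d ∧ onXLine y z n = onXLine y z e * q := by
    intro G e n h y z hGyz
    obtain ⟨q, hq, h⟩ := h y z
    rw [map_mul, map_mul, mul_assoc] at h
    exact ⟨q, hq, mul_left_cancel₀ hGyz h⟩
  suffices IsUnit e by
    exact mul_dvd_mul_left G this.dvd
  have ff := fun f : F[X][X][X] => (innerDegree_flip_le f)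
  -- The resultant argument is run in the direction where `e` has the larger degree, so that both
  -- degrees become zero.
  rcases le_total (flip e).natDegree e.natDegree with hle | hle
  · have h0 := natDegree_eq_zero_of_isRelPrime (d := d) (z := z) he hG hrel.symm (by omega)
      (by omega) hle (by omega) (by omega) (by omega) hz (by omega) (hcancel hx)
    exact isUnit_of_natDegree_eq_zero he h0 (by omega)
  · have h0 := natDegree_eq_zero_of_isRelPrime (d := d) (z := z) (hfl he) (hfl hG)
      (isRelPrime_flip hrel.symm) (by omega) (by simp only [flip_flip]; omega)
      (by simp only [flip_flip]; omega)
      ((ff e).trans (by omega)) ((ff n).trans (by omega)) ((ff G).trans (by omega)) hz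
      (by simp only [flip_flip]; omega)
      (hcancel (by simpa only [map_mul] using hy))
    exact isUnit_of_natDegree_eq_zero he (by omega) h0

end Divisibility
-- Reed–Solomon codes: duality and interpolation
section ReedSolomon

variable {F : Type*} [Field F]

theorem mem_reedSolomon_iff {d : ℕ} {g : F → F} :
    g ∈ reedSolomon F d ↔ ∃ P : F[X], P.natDegree ≤ d ∧ ∀ a, g a = P.eval a := by
  simp only [reedSolomon, Submodule.mem_map, mem_degreeLE, ← natDegree_le_iff_degree_le]
  refine exists_congr fun P => and_congr_right fun _ => ?_
  rw [eq_comm, funext_iff]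
  rfl

theorem eval_mem_reedSolomon {d : ℕ} {P : F[X]} (h : P.natDegree ≤ d) :
    (fun a => P.eval a) ∈ reedSolomon F d :=
  mem_reedSolomon_iff.2 ⟨P, h, fun _ => rfl⟩

theorem mul_mem_reedSolomon {d e : ℕ} {g g' : F → F} (h : g ∈ reedSolomon F d)
    (h' : g' ∈ reedSolomon F e) : (fun a => g a * g' a) ∈ reedSolomon F (d + e) := by
  obtain ⟨P, hP, hg⟩ := mem_reedSolomon_iff.1 h
  obtain ⟨Q, hQ, hg'⟩ := mem_reedSolomon_iff.1 h'
  exact mem_reedSolomon_iff.2 ⟨P * Q, natDegree_mul_le.trans (add_le_add hP hQ),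
    fun a => by rw [hg, hg', eval_mul]⟩

theorem comp_affine_mem_reedSolomon {d : ℕ} {g : F → F} (h : g ∈ reedSolomon F d) (u w : F) :
    (fun a => g (u * a + w)) ∈ reedSolomon F d := by
  obtain ⟨P, hP, hg⟩ := mem_reedSolomon_iff.1 h
  refine mem_reedSolomon_iff.2 ⟨P.comp (C u * X + C w), ?_, fun a => by simp [hg]⟩
  refine natDegree_comp_le.trans (le_trans ?_ hP)
  exact (Nat.mul_le_mul_left _ natDegree_linear_le).trans_eq (mul_one _)

theorem const_mem_reedSolomon (d : ℕ) (r : F) : (fun _ => r) ∈ reedSolomon F d :=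
  mem_reedSolomon_iff.2 ⟨C r, by simp, by simp⟩

theorem linear_pow_mem_reedSolomon (u w : F) (n : ℕ) :
    (fun a => (u * a + w) ^ n) ∈ reedSolomon F n :=
  mem_reedSolomon_iff.2 ⟨(C u * X + C w) ^ n,
    (natDegree_pow_le_of_le n natDegree_linear_le).trans_eq (mul_one n), by simp⟩

variable [Fintype F]

local notation "q" => Fintype.card F

theorem sum_eval_eq {P : F[X]} (h : P.natDegree < q) : ∑ a : F, P.eval a = -P.coeff (q - 1) := by
  have hq : 0 < q := Fintype.card_pos
  have htop : ∑ a : F, a ^ (q - 1) = -1 := by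
    classical
    have hone : 0 < q - 1 := by have := Fintype.one_lt_card (α := F); omega
    have : ∀ a : F, a ^ (q - 1) = 1 - if a = 0 then 1 else 0 := by
      intro a
      split_ifs with h0
      · simp [h0, hone.ne']
      · rw [FiniteField.pow_card_sub_one_eq_one a h0, sub_zero]
    simp_rw [this, Finset.sum_sub_distrib]
    simp
  simp_rw [eval_eq_sum_range' h]
  rw [Finset.sum_comm, Finset.sum_eq_single (q - 1)]
  · rw [← Finset.mul_sum, htop, mul_neg_one]
  · intro j hj hne
    rw [← Finset.mul_sum, FiniteField.sum_pow_lt_card_sub_one F j, mul_zero]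
    have := Finset.mem_range.1 hj
    omega
  · intro hn
    exact absurd (Finset.mem_range.2 (by omega)) hn

theorem sum_eq_zero_of_mem_reedSolomon {n : ℕ} {g : F → F} (h : g ∈ reedSolomon F n)
    (hn : n < q - 1) : ∑ a, g a = 0 := by
  obtain ⟨P, hP, hg⟩ := mem_reedSolomon_iff.1 h
  simp_rw [hg]
  rw [sum_eval_eq (by omega), coeff_eq_zero_of_natDegree_lt (by omega), neg_zero]

theorem exists_natDegree_lt_card (g : F → F) : ∃ P : F[X], P.natDegree < q ∧ ∀ a, g a = P.eval a := by
  classical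
  have hinj : Set.InjOn (id : F → F) (Finset.univ : Finset F) := Function.injective_id.injOn
  refine ⟨Lagrange.interpolate Finset.univ id g, ?_, fun a =>
    (Lagrange.eval_interpolate_at_node g hinj (Finset.mem_univ a)).symm⟩
  have h := Lagrange.degree_interpolate_lt g hinj
  rw [Finset.card_univ] at h
  by_cases h0 : Lagrange.interpolate Finset.univ id g = 0
  · rw [h0, natDegree_zero]; exact Fintype.card_pos
  · exact (natDegree_lt_iff_degree_lt h0).2 h

/-- If the interpolating polynomial has degree `n > D`, its pairing with `a ^ (q - 1 - n)` is minus
its leading coefficient, because only the exponent `q - 1` contributes to a sum over `F`. -/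
theorem mem_reedSolomon_of_sum_eq_zero {D : ℕ} {g : F → F}
    (h : ∀ m, m + D < q - 1 → ∑ a, g a * a ^ m = 0) : g ∈ reedSolomon F D := by
  obtain ⟨P, hP, hg⟩ := exists_natDegree_lt_card g
  refine mem_reedSolomon_iff.2 ⟨P, ?_, hg⟩
  by_contra! hlt
  have h0 := h (q - 1 - P.natDegree) (by omega)
  have : ∀ a, g a * a ^ (q - 1 - P.natDegree) = (P * X ^ (q - 1 - P.natDegree)).eval a := by
    intro a; simp [hg]
  simp_rw [this] at h0
  have hP0 : P ≠ 0 := by rintro rfl; simp at hlt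
  rw [sum_eval_eq, neg_eq_zero, coeff_mul_X_pow', if_pos (by omega)] at h0
  · have : q - 1 - (q - 1 - P.natDegree) = P.natDegree := by omega
    rw [this] at h0
    exact hP0 (leadingCoeff_eq_zero.1 h0)
  · rw [natDegree_mul_X_pow _ hP0]; omega

/-- Lagrange interpolation of Reed-Solomon codewords. -/
theorem exists_interpolation (D : ℕ) (hD : D < q) : ∃ (s : Finset F) (L : F → F[X]),
    (∀ i ∈ s, (L i).natDegree ≤ D) ∧
    ∀ g ∈ reedSolomon F D, ∀ x, g x = ∑ i ∈ s, g i * (L i).eval x := by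
  classical
  obtain ⟨s, -, hs⟩ := Finset.exists_subset_card_eq (s := (Finset.univ : Finset F)) (n := D + 1)
    (by rw [Finset.card_univ]; omega)
  have hinj : Set.InjOn (id : F → F) s := Function.injective_id.injOn
  refine ⟨s, Lagrange.basis s id, fun i hi => ?_, fun g hg x => ?_⟩
  · have := Lagrange.degree_basis hinj hi
    rw [natDegree_le_iff_degree_le, this, hs]
    simp
  · obtain ⟨P, hP, hg⟩ := mem_reedSolomon_iff.1 hg
    have := Lagrange.eq_interpolate_of_eval_eq (f := P) (fun i => P.eval i) hinj (by
      rw [hs]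
      exact degree_le_natDegree.trans_lt (by exact_mod_cast Nat.lt_succ_of_le hP)) (fun i _ => rfl)
    simp only [hg]
    conv_lhs => rw [this]
    simp [Lagrange.interpolate_apply, eval_finsetSum]

end ReedSolomon

/-! ### The degree of codewords in the third variable -/

section VertexCode

variable {F : Type*} [Field F] [Fintype F]

local notation "q" => Fintype.card F

theorem sum_mul_eq_zero_of_x {A B e : ℕ} {f : F × F × F → F} (hf : f ∈ vertexCode F A B)
    {w : F → F → F → F} (hw : ∀ y z, (fun x => w x y z) ∈ reedSolomon F e) (he : e + A < q - 1) :
    ∑ x, ∑ y, ∑ z, w x y z * f (x, y, z) = 0 := by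
  rw [Finset.sum_comm]
  refine Finset.sum_eq_zero fun y _ => ?_
  rw [Finset.sum_comm]
  exact Finset.sum_eq_zero fun z _ =>
    sum_eq_zero_of_mem_reedSolomon (mul_mem_reedSolomon (hw y z) (hf.1 y z)) he

theorem sum_mul_eq_zero_of_y {A B e : ℕ} {f : F × F × F → F} (hf : f ∈ vertexCode F A B)
    {w : F → F → F → F} (hw : ∀ x c, (fun y => w x y (x * y + c)) ∈ reedSolomon F e)
    (he : e + B < q - 1) : ∑ x, ∑ y, ∑ z, w x y z * f (x, y, z) = 0 := by
  refine Finset.sum_eq_zero fun x _ => ?_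
  have : ∀ y, ∑ z, w x y z * f (x, y, z) = ∑ c, w x y (x * y + c) * f (x, y, x * y + c) :=
    fun y => (Equiv.sum_comp (Equiv.addLeft (x * y)) fun z => w x y z * f (x, y, z)).symm
  simp_rw [this]
  rw [Finset.sum_comm]
  exact Finset.sum_eq_zero fun c _ =>
    sum_eq_zero_of_mem_reedSolomon (mul_mem_reedSolomon (hw x c) (hf.2 x c)) he

/-- The codewords of `C_{A, B}` have degree at most `A + B` in `z`. -/
theorem mem_reedSolomon_z {A B : ℕ} {f : F × F × F → F} (hf : f ∈ vertexCode F A B)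
    (x₀ y₀ : F) : (fun z => f (x₀, y₀, z)) ∈ reedSolomon F (A + B) := by
  classical
  refine mem_reedSolomon_of_sum_eq_zero fun m hm => ?_
  -- `Z` is constant on lines of the first family and linear on those of the second; for `W` it is
  -- the reverse. Moreover `Z = z` at `y = y₀`, and `Z - W = (x - x₀) (y - y₀)`.
  let Z : F → F → F := fun y z => z - x₀ * y + x₀ * y₀
  let W : F → F → F → F := fun x y z => z - x * y + x * y₀
  set n := q - 1 with hn
  have hn0 : n ≠ 0 := by omega
  have hdelta : ∀ a b : F, 1 - (a - b) ^ n = if a = b then 1 else 0 := by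
    intro a b
    split_ifs with h
    · simp [h, hn0]
    · rw [FiniteField.pow_card_sub_one_eq_one _ (sub_ne_zero.2 h), sub_self]
  have h1 : ∑ z, f (x₀, y₀, z) * z ^ m =
      ∑ x, ∑ y, ∑ z, ((1 - (x - x₀) ^ n) * (1 - (y - y₀) ^ n) * Z y z ^ m) * f (x, y, z) := by
    simp_rw [hdelta]
    symm
    rw [Finset.sum_eq_single x₀ (fun x _ hx => by simp [hx]) (by simp),
      Finset.sum_eq_single y₀ (fun y _ hy => by simp [hy]) (by simp)]
    simp [Z, mul_comm]
  -- Expand the indicator of `(x₀, y₀)`, and its cross term by the binomial theorem in `Z` and `-W`.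
  -- Each resulting weight has low degree along one of the two families, so its pairing with `f` is
  -- zero.
  have h2 : ∀ x y z : F, ((1 - (x - x₀) ^ n) * (1 - (y - y₀) ^ n) * Z y z ^ m) * f (x, y, z) =
      ((1 - (y - y₀) ^ n) * Z y z ^ m) * f (x, y, z) + (-(x - x₀) ^ n * Z y z ^ m) * f (x, y, z) +
      ∑ r ∈ Finset.range (n + 1),
        (Z y z ^ (r + m) * (-W x y z) ^ (n - r) * n.choose r) * f (x, y, z) := by
    intro x y z
    have h3 : (x - x₀) ^ n * (y - y₀) ^ n * Z y z ^ m =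
        ∑ r ∈ Finset.range (n + 1), Z y z ^ (r + m) * (-W x y z) ^ (n - r) * n.choose r := by
      have : (x - x₀) * (y - y₀) = Z y z + -W x y z := by simp only [Z, W]; ring
      rw [← mul_pow, this, add_pow, Finset.sum_mul]
      exact Finset.sum_congr rfl fun r _ => by ring
    rw [← Finset.sum_mul, ← h3]
    ring
  rw [h1]
  simp_rw [h2, Finset.sum_add_distrib]
  have hZ : ∀ x c j, (fun y => Z y (x * y + c) ^ j) ∈ reedSolomon F j := by
    intro x c j
    convert linear_pow_mem_reedSolomon (x - x₀) (c + x₀ * y₀) j using 3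
    simp only [Z]; ring
  have hW : ∀ y z j, (fun x => (-W x y z) ^ j) ∈ reedSolomon F j := by
    intro y z j
    convert linear_pow_mem_reedSolomon (y - y₀) (-z) j using 3
    simp only [W]; ring
  rw [sum_mul_eq_zero_of_x hf (e := 0) (w := fun x y z => (1 - (y - y₀) ^ n) * Z y z ^ m)
      (fun y z => const_mem_reedSolomon 0 _) (by omega),
    sum_mul_eq_zero_of_y hf (e := 0 + m) (w := fun x y z => -(x - x₀) ^ n * Z y z ^ m)
      (fun x c => mul_mem_reedSolomon (const_mem_reedSolomon 0 (-(x - x₀) ^ n)) (hZ x c m))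
      (by omega), zero_add, zero_add]
  have hswap : ∀ T : F → F → F → ℕ → F,
      ∑ x, ∑ y, ∑ z, ∑ r ∈ Finset.range (n + 1), T x y z r =
      ∑ r ∈ Finset.range (n + 1), ∑ x, ∑ y, ∑ z, T x y z r := by
    intro T
    symm
    rw [Finset.sum_comm]
    refine Finset.sum_congr rfl fun x _ => ?_
    rw [Finset.sum_comm]
    refine Finset.sum_congr rfl fun y _ => ?_
    rw [Finset.sum_comm]
  rw [hswap]
  refine Finset.sum_eq_zero fun r hr => ?_
  have hr' := Finset.mem_range.1 hr
  -- The weight `Z^(r+m) W^(n-r)` has degree `n - r` along the first family and `r + m` along the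
  -- second. For `r > A` the first is small enough, for `r ≤ A` the second, by `m + A + B < q - 1`.
  by_cases hrA : A < r
  · refine sum_mul_eq_zero_of_x hf (e := 0 + (n - r) + 0)
      (w := fun x y z => Z y z ^ (r + m) * (-W x y z) ^ (n - r) * n.choose r)
      (fun y z => mul_mem_reedSolomon (mul_mem_reedSolomon (const_mem_reedSolomon 0 _)
        (hW y z (n - r))) (const_mem_reedSolomon 0 _)) (by omega)
  · refine sum_mul_eq_zero_of_y hf (e := (r + m) + 0 + 0)
      (w := fun x y z => Z y z ^ (r + m) * (-W x y z) ^ (n - r) * n.choose r)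
      (fun x c => mul_mem_reedSolomon (mul_mem_reedSolomon (hZ x c (r + m)) ?_)
        (const_mem_reedSolomon 0 _)) (by omega)
    convert const_mem_reedSolomon 0 ((-(c + x * y₀)) ^ (n - r)) using 3
    simp only [W]; ring

end VertexCode

/-! ### Codewords as polynomials with formal degree bounds -/

section Interpolation

variable {F : Type*} [Field F]

/-- Evaluation at `(y, z)` of a polynomial in `F[y][z]`. -/
noncomputable def eval2 (y z : F) : F[X][X] →+* F := eval₂RingHom (evalRingHom y) z

theorem innerDegree_mul_le {R : Type*} [CommRing R] (f g : R[X][X]) :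
    innerDegree (f * g) ≤ innerDegree f + innerDegree g := by
  rw [innerDegree, map_mul]
  exact natDegree_mul_le

theorem innerDegree_sum_le {R ι : Type*} [CommRing R] (s : Finset ι) (f : ι → R[X][X]) (n : ℕ)
    (h : ∀ i ∈ s, innerDegree (f i) ≤ n) : innerDegree (∑ i ∈ s, f i) ≤ n := by
  rw [innerDegree, map_sum]
  exact natDegree_sum_le_of_forall_le _ _ h

theorem innerDegree_C {R : Type*} [CommRing R] (f : R[X]) : innerDegree (C f) ≤ f.natDegree := by
  rw [innerDegree, Bivariate.swap_C]
  exact natDegree_map_le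

/-- The degree in `y` of `f(y, x, x y - z)` is at most the sum of the degrees of `f` in `x`
and in `z`. -/
theorem natDegree_coeff_coeff_flip_le (f : F[X][X][X]) (i k : ℕ) :
    (((flip f).coeff i).coeff k).natDegree ≤ f.natDegree + innerDegree f := by
  -- `κ` makes `y` the outermost variable, so that the degree in `y` becomes a `natDegree`.
  let κ : F[X][X][X] →+* F[X][X][X] :=
    Bivariate.swap.toRingHom.comp (mapRingHom Bivariate.swap.toRingHom)
  have hκ : ∀ (g : F[X][X][X]) (i j k : ℕ),
      (((κ g).coeff j).coeff i).coeff k = ((g.coeff i).coeff k).coeff j := by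
    intro g i j k
    have : κ g = Bivariate.swap (g.map Bivariate.swap.toRingHom) := rfl
    rw [this, coeff_coeff_swap, coeff_map]
    exact coeff_coeff_swap _ _ _
  let ψ' : F[X] →+* F[X][X][X] := C.comp (mapRingHom C)
  let ψ : F[X][X] →+* F[X][X][X] := eval₂RingHom (S := F[X][X][X]) ψ' (C X * X - C (C X))
  let Ψ : F[X][X][X] →+* F[X][X][X] := eval₂RingHom (S := F[X][X][X]) ψ X
  have key : κ.comp flip = Ψ := by
    apply ringHom_ext₃ <;> intros <;>
      simp [κ, ψ, ψ', Ψ, flip_C_C_C, flip_x, flip_y, flip_z, Bivariate.swap_Y, Bivariate.swap_C]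
    refine (map_sub (Bivariate.swap (R := F[X])) _ _).trans ?_
    rw [map_mul, Bivariate.swap_X, Bivariate.swap_Y, Bivariate.swap_C_C, mul_comm]
  have hψ : ∀ a, (ψ a).natDegree ≤ a.natDegree := by
    intro a
    have : ψ a = a.sum fun k b => ψ' b * (C X * X - C (C X)) ^ k := eval₂_eq_sum
    rw [this, Polynomial.sum]
    refine natDegree_sum_le_of_forall_le _ _ fun k hk => ?_
    refine (natDegree_C_mul_le _ _).trans ?_
    have h1 : (C X * X - C (C X) : F[X][X][X]).natDegree ≤ 1 := by compute_degree
    exact (natDegree_pow_le_of_le k h1).trans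
      ((mul_one k).trans_le (le_natDegree_of_mem_supp k hk))
  have hΨ : (Ψ f).natDegree ≤ f.natDegree + innerDegree f := by
    have : Ψ f = f.sum fun k b => ψ b * X ^ k := eval₂_eq_sum
    rw [this, Polynomial.sum]
    refine natDegree_sum_le_of_forall_le _ _ fun k hk => ?_
    refine natDegree_mul_le.trans ?_
    rw [natDegree_X_pow]
    have h1 := (hψ (f.coeff k)).trans (natDegree_coeff_le_innerDegree f k)
    have h2 := le_natDegree_of_mem_supp k hk
    omega
  rw [natDegree_le_iff_coeff_eq_zero]
  intro N hN
  have : κ (flip f) = Ψ f := congrArg (fun φ => φ f) key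
  rw [← hκ, this, coeff_eq_zero_of_natDegree_lt (hΨ.trans_lt hN), coeff_zero, coeff_zero]

/-- The polynomial `P(z - u y)`. -/
noncomputable def shear (u : F) : F[X] →+* F[X][X] :=
  eval₂RingHom (C.comp C) (X - C (C u * X))

theorem natDegree_shear_le (u : F) (P : F[X]) : (shear u P).natDegree ≤ P.natDegree := by
  have : shear u P = P.sum fun k b => C (C b) * (X - C (C u * X)) ^ k := eval₂_eq_sum
  rw [this, Polynomial.sum]
  refine natDegree_sum_le_of_forall_le _ _ fun k hk => ?_
  refine (natDegree_C_mul_le _ _).trans ?_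
  exact (natDegree_pow_le_of_le k (natDegree_X_sub_C_le _)).trans
    ((mul_one k).trans_le (le_natDegree_of_mem_supp k hk))

theorem innerDegree_shear_le (u : F) (P : F[X]) : innerDegree (shear u P) ≤ P.natDegree := by
  have key : Bivariate.swap.toRingHom.comp (shear u) =
      eval₂RingHom (C.comp C) (C X - C (C u) * X) := by
    refine ringHom_ext' (RingHom.ext fun a => ?_) ?_ <;>
      simp [shear, Bivariate.swap_Y, Bivariate.swap_C]
  have : Bivariate.swap (shear u P) = P.sum fun k b => C (C b) * (C X - C (C u) * X) ^ k :=
    (congrArg (fun φ => φ P) key).trans eval₂_eq_sum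
  rw [innerDegree, this, Polynomial.sum]
  refine natDegree_sum_le_of_forall_le _ _ fun k hk => ?_
  refine (natDegree_C_mul_le _ _).trans ?_
  have h1 : (C X - C (C u) * X : F[X][X]).natDegree ≤ 1 := by compute_degree
  exact (natDegree_pow_le_of_le k h1).trans
    ((mul_one k).trans_le (le_natDegree_of_mem_supp k hk))

theorem eval2_shear (u y z : F) (P : F[X]) : eval2 y z (shear u P) = P.eval (z - u * y) := by
  have : (eval2 y z).comp (shear u) = evalRingHom (z - u * y) := by
    refine ringHom_ext' (RingHom.ext fun a => ?_) ?_ <;> simp [shear, eval2]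
  exact congrArg (fun φ => φ P) this

variable [Fintype F]

local notation "q" => Fintype.card F

theorem eq_of_eval2_eq {f g : F[X][X]} (hf : f.natDegree < q) (hg : g.natDegree < q)
    (hf' : innerDegree f < q) (hg' : innerDegree g < q)
    (h : ∀ y z, eval2 y z f = eval2 y z g) : f = g := by
  have h1 : ∀ y : F, f.map (evalRingHom y) = g.map (evalRingHom y) := by
    intro y
    refine eq_of_natDegree_lt_card_of_eval_eq _ _ Function.injective_id (fun z => ?_)
      (max_lt (natDegree_map_le.trans_lt hf) (natDegree_map_le.trans_lt hg))
    simpa [eval_map, eval2] using h y z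
  ext i : 1
  refine eq_of_natDegree_lt_card_of_eval_eq _ _ Function.injective_id (fun y => ?_)
    (max_lt ((natDegree_coeff_le_innerDegree _ _).trans_lt hf')
      ((natDegree_coeff_le_innerDegree _ _).trans_lt hg'))
  simpa [coeff_map] using congrArg (coeff · i) (h1 y)

/-- Every codeword of `C_{A, B}` is given by a polynomial that satisfies the degree conditions
formally. -/
theorem exists_poly_of_mem_vertexCode {A B : ℕ} (h1 : A + 2 * B < q) (h2 : 2 * A + B < q)
    {f : F × F × F → F} (hf : f ∈ vertexCode F A B) :
    ∃ N : F[X][X][X], N.natDegree ≤ A ∧ (flip N).natDegree ≤ B ∧ innerDegree N ≤ A + B ∧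
      ∀ x y z, eval3 x y z N = f (x, y, z) := by
  obtain ⟨sA, LA, hLA, hA⟩ := exists_interpolation (F := F) A (by omega)
  obtain ⟨sB, LB, hLB, hB⟩ := exists_interpolation (F := F) B (by omega)
  obtain ⟨sD, LD, hLD, hD⟩ := exists_interpolation (F := F) (A + B) (by omega)
  -- For fixed `x`, interpolate in `y` along the lines of the second family and in their parameter
  -- `z - x y`. The latter is legitimate by `mem_reedSolomon_z`.
  let H : F → F[X][X] := fun x => ∑ j ∈ sB, ∑ l ∈ sD,
    C (C (f (x, j, x * j + l)) * LB j) * shear x (LD l)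
  have hHdeg : ∀ x, (H x).natDegree ≤ A + B := by
    refine fun x => natDegree_sum_le_of_forall_le _ _ fun j _ =>
      natDegree_sum_le_of_forall_le _ _ fun l hl => ?_
    exact (natDegree_C_mul_le _ _).trans ((natDegree_shear_le _ _).trans (hLD l hl))
  have hHinner : ∀ x, innerDegree (H x) ≤ A + 2 * B := by
    refine fun x => innerDegree_sum_le _ _ _ fun j hj =>
      innerDegree_sum_le _ _ _ fun l hl => ?_
    have h3 := (innerDegree_C _).trans
      ((natDegree_C_mul_le (f (x, j, x * j + l)) (LB j)).trans (hLB j hj))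
    have h4 := (innerDegree_shear_le x (LD l)).trans (hLD l hl)
    exact (innerDegree_mul_le _ _).trans (by omega)
  have hHeval : ∀ x y z, eval2 y z (H x) = f (x, y, z) := by
    intro x y z
    have e1 : f (x, y, z) = ∑ j ∈ sB, f (x, j, x * j + (z - x * y)) * (LB j).eval y := by
      rw [← hB _ (hf.2 x (z - x * y)) y]
      rw [add_sub_cancel]
    have e2 : ∀ j, f (x, j, x * j + (z - x * y)) =
        ∑ l ∈ sD, f (x, j, x * j + l) * (LD l).eval (z - x * y) := by
      intro j
      refine hD (fun l => f (x, j, x * j + l)) ?_ _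
      simpa only [one_mul, add_comm] using
        comp_affine_mem_reedSolomon (mem_reedSolomon_z hf x j) 1 (x * j)
    rw [e1, map_sum]
    refine Finset.sum_congr rfl fun j _ => ?_
    rw [e2, map_sum, Finset.sum_mul]
    refine Finset.sum_congr rfl fun l _ => ?_
    rw [map_mul, eval2_shear]
    simp only [eval2, coe_eval₂RingHom, eval₂_C, coe_evalRingHom, eval_mul, eval_C]
    ring
  let N : F[X][X][X] := ∑ i ∈ sA, C (H i) * (LA i).map (C.comp C)
  have hNdeg : N.natDegree ≤ A := natDegree_sum_le_of_forall_le _ _ fun i hi =>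
    (natDegree_C_mul_le _ _).trans (natDegree_map_le.trans (hLA i hi))
  have hNinner : innerDegree N ≤ A + B := by
    rw [innerDegree_le_iff]
    intro m
    rw [finsetSum_coeff]
    refine natDegree_sum_le_of_forall_le _ _ fun i _ => ?_
    rw [coeff_C_mul, coeff_map]
    exact (natDegree_mul_C_le _ _).trans (hHdeg i)
  have hNeval : ∀ x y z, eval3 x y z N = f (x, y, z) := by
    intro x y z
    rw [hA _ (hf.1 y z) x, map_sum]
    refine Finset.sum_congr rfl fun i _ => ?_
    have e1 : eval3 x y z (C (H i)) = eval2 y z (H i) := by simp [eval3, eval2]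
    have e2 : eval3 x y z ((LA i).map (C.comp C)) = (LA i).eval x := by
      have : (eval3 x y z).comp (mapRingHom (C.comp C)) = evalRingHom x := by
        refine ringHom_ext' (RingHom.ext fun a => ?_) ?_ <;> simp [eval3]
      exact congrArg (fun φ => φ (LA i)) this
    rw [map_mul, e1, e2, hHeval]
  -- `N` interpolates `H` from the nodes in `sA` only. At every other `x` the two sides have equal
  -- values and degrees below `q` in `y` and `z`, hence coincide as polynomials.
  have hNH : ∀ x, N.eval (C (C x)) = H x := by
    intro x
    have hx : N.eval (C (C x)) = ∑ i ∈ sA, H i * C (C ((LA i).eval x)) := by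
      rw [eval_finsetSum]
      refine Finset.sum_congr rfl fun i _ => ?_
      rw [eval_mul, eval_C, eval_map]
      have := eval₂_at_apply (p := LA i) ((C.comp C : F →+* F[X][X])) x
      simp only [RingHom.comp_apply] at this
      rw [this]
    refine eq_of_eval2_eq ?_ ((hHdeg x).trans_lt (by omega)) ?_
      ((hHinner x).trans_lt h1) fun y z => ?_
    · rw [hx]
      exact (natDegree_sum_le_of_forall_le _ _ fun i _ =>
        (natDegree_mul_C_le _ _).trans (hHdeg i)).trans_lt (by omega)
    · rw [hx]
      refine (innerDegree_sum_le _ _ (A + 2 * B) fun i _ => ?_).trans_lt h1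
      have h3 := innerDegree_C (C ((LA i).eval x))
      rw [natDegree_C] at h3
      have h4 := hHinner i
      exact (innerDegree_mul_le _ _).trans (by omega)
    · rw [hHeval, ← hNeval]
      have : (eval2 y z).comp (evalRingHom (C (C x))) = eval3 x y z := by
        apply ringHom_ext₃ <;> intros <;> simp [eval2, eval3]
      exact congrArg (fun φ => φ N) this
  refine ⟨N, hNdeg, ?_, hNinner, hNeval⟩
  rw [natDegree_le_iff_coeff_eq_zero]
  intro J hJ
  ext k : 1
  rw [coeff_zero]
  refine eq_zero_of_natDegree_lt_card_of_eval_eq_zero _ Function.injective_id (fun y => ?_)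
    ((natDegree_coeff_coeff_flip_le N J k).trans_lt (by omega : _ < q))
  -- `Θ` is what `flip` becomes when the first argument of `N` is fixed to be `y`. It sends `z - y ·
  -- (second argument)` to `-z`, so only the factors `LB j` contribute to the outer degree of `Θ (H
  -- y)`. Thus the coefficients of `flip N` beyond degree `B` vanish at all `y`, and their degree in
  -- `y` is less than `q`.
  let Θ : F[X][X] →+* F[X][X] :=
    eval₂RingHom (mapRingHom C) (C (C y) * X - C X)
  have key : (mapRingHom (mapRingHom (evalRingHom y))).comp flip =
      Θ.comp (evalRingHom (C (C y))) := by
    apply ringHom_ext₃ <;> intros <;>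
      simp [Θ, flip_C_C_C, flip_x, flip_y, flip_z]
  have key' : (flip N).map (mapRingHom (evalRingHom y)) = Θ (N.eval (C (C y))) :=
    congrArg (fun φ => φ N) key
  have hdeg : (Θ (H y)).natDegree ≤ B := by
    rw [map_sum]
    refine natDegree_sum_le_of_forall_le _ _ fun j hj => ?_
    rw [map_sum]
    refine natDegree_sum_le_of_forall_le _ _ fun l hl => ?_
    have hsh : Θ.comp (shear y) = C.comp (compRingHom (-X)) := by
      refine ringHom_ext' (RingHom.ext fun a => ?_) ?_ <;> simp [shear, Θ]
    have hsh' : Θ (shear y (LD l)) = C ((LD l).comp (-X)) := congrArg (fun φ => φ (LD l)) hsh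
    rw [map_mul, hsh']
    refine (natDegree_mul_C_le _ _).trans ?_
    have : Θ (C (C (f (y, j, y * j + l)) * LB j)) =
        (C (f (y, j, y * j + l)) * LB j).map C := by simp [Θ]
    rw [this]
    exact natDegree_map_le.trans ((natDegree_C_mul_le _ _).trans (hLB j hj))
  have := congrArg (fun g => (g.coeff J).coeff k) key'
  rw [hNH] at this
  simp only [coeff_map, coeff_eq_zero_of_natDegree_lt (hdeg.trans_lt hJ)] at this
  simpa using this

end Interpolation

/-! ### A nonzero polynomial vanishing at given points -/

section Monomials

variable {F : Type*} [Field F]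

/-- The polynomial with coefficients `c` and exponents `(i, j, k)` of `x`, `y`, `z` in `M`. -/
noncomputable def polyOf (M : Finset (ℕ × ℕ × ℕ)) (c : ℕ × ℕ × ℕ → F) : F[X][X][X] :=
  ∑ m ∈ M, monomial m.1 (monomial m.2.2 (monomial m.2.1 (c m)))

theorem eval3_polyOf (M : Finset (ℕ × ℕ × ℕ)) (c : ℕ × ℕ × ℕ → F) (x y z : F) :
    eval3 x y z (polyOf M c) = ∑ m ∈ M, c m * (x ^ m.1 * y ^ m.2.1 * z ^ m.2.2) := by
  rw [polyOf, map_sum]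
  refine Finset.sum_congr rfl fun m _ => ?_
  simp only [eval3, coe_eval₂RingHom, eval₂_monomial, coe_evalRingHom, eval_monomial]
  ring

theorem coeff_polyOf (M : Finset (ℕ × ℕ × ℕ)) (c : ℕ × ℕ × ℕ → F) {m : ℕ × ℕ × ℕ} (hm : m ∈ M) :
    (((polyOf M c).coeff m.1).coeff m.2.2).coeff m.2.1 = c m := by
  simp only [polyOf, finsetSum_coeff]
  rw [Finset.sum_eq_single m]
  · simp
  · intro n _ hne
    simp only [coeff_monomial]
    split_ifs with h1
    · rw [coeff_monomial]
      split_ifs with h2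
      · rw [coeff_monomial]
        split_ifs with h3
        · exact absurd (Prod.ext h1 (Prod.ext h3 h2)) hne
        · rfl
      · simp
    · simp
  · exact fun h => absurd hm h

theorem natDegree_polyOf_le {M : Finset (ℕ × ℕ × ℕ)} (c : ℕ × ℕ × ℕ → F) {A : ℕ}
    (h : ∀ m ∈ M, m.1 ≤ A) : (polyOf M c).natDegree ≤ A :=
  natDegree_sum_le_of_forall_le _ _ fun m hm => (natDegree_monomial_le _).trans (h m hm)

theorem innerDegree_polyOf_le {M : Finset (ℕ × ℕ × ℕ)} (c : ℕ × ℕ × ℕ → F) {A : ℕ}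
    (h : ∀ m ∈ M, m.2.2 ≤ A) : innerDegree (polyOf M c) ≤ A := by
  refine innerDegree_sum_le _ _ _ fun m hm => ?_
  rw [innerDegree_le_iff]
  intro i
  rw [coeff_monomial]
  split_ifs
  · exact (natDegree_monomial_le _).trans (h m hm)
  · simp

/-- The monomial `x^i y^j z^k` becomes `y^i x^j (x y - z)^k`, whose degree in `x` is `j + k`. -/
theorem natDegree_flip_polyOf_le {M : Finset (ℕ × ℕ × ℕ)} (c : ℕ × ℕ × ℕ → F) {B : ℕ}
    (h : ∀ m ∈ M, m.2.1 + m.2.2 ≤ B) : (flip (polyOf M c)).natDegree ≤ B := by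
  rw [polyOf, map_sum]
  refine natDegree_sum_le_of_forall_le _ _ fun m hm => le_trans ?_ (h m hm)
  have e : flip (monomial m.1 (monomial m.2.2 (monomial m.2.1 (c m)))) =
      C (C (C (c m) * X ^ m.1)) * (X ^ m.2.1 * (X * C (C X) - C X) ^ m.2.2) := by
    simp only [← C_mul_X_pow_eq_monomial, map_mul, map_pow, flip_C_C_C, flip_x, flip_y, flip_z]
    ring
  rw [e]
  refine (natDegree_C_mul_le _ _).trans (natDegree_mul_le.trans ?_)
  have h1 : (X * C (C X) - C X : F[X][X][X]).natDegree ≤ 1 := by compute_degree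
  rw [natDegree_X_pow]
  exact Nat.add_le_add_left ((natDegree_pow_le_of_le _ h1).trans_eq (mul_one _)) _

/-- There is a nonzero polynomial with exponents in `M` that vanishes at fewer than `|M|` given
points. -/
theorem exists_polyOf_eq_zero {T : Type*} [Finite T] (v : T → F × F × F)
    {M : Finset (ℕ × ℕ × ℕ)} (hM : Nat.card T < M.card) :
    ∃ c : ℕ × ℕ × ℕ → F, polyOf M c ≠ 0 ∧
      ∀ t, eval3 (v t).1 (v t).2.1 (v t).2.2 (polyOf M c) = 0 := by
  classical
  have := Fintype.ofFinite T
  let Φ : (M → F) →ₗ[F] (T → F) :=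
    { toFun := fun c t => ∑ m : M, c m * ((v t).1 ^ m.1.1 * (v t).2.1 ^ m.1.2.1 *
        (v t).2.2 ^ m.1.2.2)
      map_add' := fun c c' => by ext t; simp [add_mul, Finset.sum_add_distrib]
      map_smul' := fun r c => by ext t; simp [Finset.mul_sum, mul_assoc] }
  have hker : LinearMap.ker Φ ≠ ⊥ := LinearMap.ker_ne_bot_of_finrank_lt (by
    simpa [Nat.card_eq_fintype_card] using hM)
  obtain ⟨c, hc, hc0⟩ := (Submodule.ne_bot_iff _).1 hker
  refine ⟨fun m => if h : m ∈ M then c ⟨m, h⟩ else 0, ?_, fun t => ?_⟩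
  · intro h0
    apply hc0
    ext m
    have := coeff_polyOf M (fun m => if h : m ∈ M then c ⟨m, h⟩ else 0) m.2
    rw [h0] at this
    simpa using this.symm
  · rw [eval3_polyOf, ← Finset.sum_coe_sort]
    have := congrFun (LinearMap.mem_ker.1 hc) t
    simpa [Φ] using this

end Monomials

/-! ### The common codeword as a quotient, and the lines where the denominator vanishes -/

section Decoding

variable {F : Type*} [Field F]

theorem eval_onXLine_flip (x y c : F) (f : F[X][X][X]) :
    (onXLine x (-c) (flip f)).eval y = eval3 x y (x * y + c) f := by
  rw [eval_onXLine, eval3_flip]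
  congr 2; ring

theorem eval3_mem_vertexCode {f : F[X][X][X]} {A B : ℕ} (hA : f.natDegree ≤ A)
    (hB : (flip f).natDegree ≤ B) :
    (fun v : F × F × F => eval3 v.1 v.2.1 v.2.2 f) ∈ vertexCode F A B := by
  refine ⟨fun y z => ?_, fun x c => ?_⟩
  · simp_rw [← eval_onXLine]
    exact eval_mem_reedSolomon ((natDegree_onXLine_le y z f).trans hA)
  · simp_rw [← eval_onXLine_flip]
    exact eval_mem_reedSolomon ((natDegree_onXLine_le _ _ _).trans hB)

variable [Fintype F]

local notation "q" => Fintype.card F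

theorem eq_of_mul_eq_mul {d a : ℕ} {E : F[X]} (hE : E ≠ 0) (ha : E.natDegree ≤ a) (had : a + d < q)
    {g g' : F → F} (hg : g ∈ reedSolomon F d) (hg' : g' ∈ reedSolomon F d)
    (h : ∀ x, E.eval x * g x = E.eval x * g' x) : g = g' := by
  obtain ⟨P, hP, hgP⟩ := mem_reedSolomon_iff.1 hg
  obtain ⟨P', hP', hgP'⟩ := mem_reedSolomon_iff.1 hg'
  have : E * P = E * P' := by
    refine eq_of_natDegree_lt_card_of_eval_eq _ _ Function.injective_id (fun x => ?_)
      (max_lt (natDegree_mul_le.trans_lt (by omega)) (natDegree_mul_le.trans_lt (by omega)))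
    simpa [hgP, hgP'] using h x
  ext x
  rw [hgP, hgP', mul_left_cancel₀ hE this]

/-- If `P` and `Q` have low degree along the two families of lines and agree off the zero set of a
polynomial `E` of low degree, then they come from a common codeword. -/
theorem exists_codeword_of_mul_eq {E : F[X][X][X]} {d : ℕ} (hE : E ≠ 0)
    (hz : 2 * innerDegree E < q)
    (hcard : 2 * (E.natDegree + (flip E).natDegree) + 4 * d < q) {P Q : F × F × F → F}
    (hP : ∀ y z, (fun x => P (x, y, z)) ∈ reedSolomon F d)
    (hQ : ∀ x c, (fun y => Q (x, y, x * y + c)) ∈ reedSolomon F d)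
    (hPQ : ∀ x y z, eval3 x y z E * P (x, y, z) = eval3 x y z E * Q (x, y, z)) :
    ∃ f ∈ vertexCode F d d, (∀ y z, onXLine y z E ≠ 0 → ∀ x, f (x, y, z) = P (x, y, z)) ∧
      ∀ x c, onXLine x (-c) (flip E) ≠ 0 → ∀ y, f (x, y, x * y + c) = Q (x, y, x * y + c) := by
  set a := E.natDegree with ha
  set b := (flip E).natDegree with hb
  -- Degrees along the first family are read off from `E P`, along the second from the equal
  -- function `E Q`.
  have hmem : (fun v : F × F × F => eval3 v.1 v.2.1 v.2.2 E * P v) ∈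
      vertexCode F (a + d) (b + d) := by
    have hEmem := eval3_mem_vertexCode (f := E) le_rfl le_rfl
    refine ⟨fun y z => mul_mem_reedSolomon (hEmem.1 y z) (hP y z), fun x c => ?_⟩
    simp only [hPQ]
    exact mul_mem_reedSolomon (hEmem.2 x c) (hQ x c)
  obtain ⟨N, hN, hN', hNz, hNeval⟩ :=
    exists_poly_of_mem_vertexCode (by omega) (by omega) hmem
  simp only at hNeval
  have hx : ∀ y z : F, ∃ p : F[X], p.natDegree ≤ d ∧ onXLine y z N = onXLine y z E * p := by
    intro y z
    obtain ⟨p, hp, hPp⟩ := mem_reedSolomon_iff.1 (hP y z)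
    refine ⟨p, hp, ?_⟩
    have h1 := natDegree_onXLine_le y z N
    have h2 := natDegree_onXLine_le y z E
    refine eq_of_natDegree_lt_card_of_eval_eq _ _ Function.injective_id (fun x => ?_)
      (max_lt (by omega) (natDegree_mul_le.trans_lt (by omega)))
    simp [eval_onXLine, hNeval, ← hPp]
  have hy : ∀ y z : F, ∃ p : F[X], p.natDegree ≤ d ∧
      onXLine y z (flip N) = onXLine y z (flip E) * p := by
    intro x c
    obtain ⟨p, hp, hQp⟩ := mem_reedSolomon_iff.1 (hQ x (-c))
    refine ⟨p, hp, ?_⟩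
    have h1 := natDegree_onXLine_le x c (flip N)
    have h2 := natDegree_onXLine_le x c (flip E)
    refine eq_of_natDegree_lt_card_of_eval_eq _ _ Function.injective_id (fun y => ?_)
      (max_lt (by omega) (natDegree_mul_le.trans_lt (by omega)))
    have h3 := eval_onXLine_flip x y (-c) N
    have h4 := eval_onXLine_flip x y (-c) E
    rw [neg_neg] at h3 h4
    rw [id, eval_mul, h3, h4, hNeval, ← hQp, hPQ]
  obtain ⟨f, rfl⟩ := dvd_of_dvd_on_lines (z := max (innerDegree E) (a + d + (b + d))) hE hN hN'
    (le_max_left _ _) (hNz.trans (le_max_right _ _)) (by omega) (by omega) hx hy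
  have hfdeg : f.natDegree ≤ d ∧ (flip f).natDegree ≤ d := by
    obtain rfl | hf := eq_or_ne f 0
    · simp
    have hfl : ∀ {f : F[X][X][X]}, f ≠ 0 → flip f ≠ 0 := fun hf h =>
      hf (flip_injective (h.trans (map_zero flip).symm))
    rw [natDegree_mul hE hf] at hN
    rw [map_mul, natDegree_mul (hfl hE) (hfl hf)] at hN'
    omega
  have hfmem := eval3_mem_vertexCode hfdeg.1 hfdeg.2
  simp only [map_mul] at hNeval
  refine ⟨_, hfmem, fun y z hyz => congrFun (eq_of_mul_eq_mul (d := d) (a := a) hyz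
      (natDegree_onXLine_le _ _ _) (by omega) (hfmem.1 y z) (hP y z) fun x => ?_),
    fun x c hxc => congrFun (eq_of_mul_eq_mul (d := d) (a := b) hxc
      (natDegree_onXLine_le _ _ _) (by omega) (hfmem.2 x c) (hQ x c) fun y => ?_)⟩
  · rw [eval_onXLine, hNeval]
  · rw [eval_onXLine_flip, hNeval, hPQ]

/-- The number of lines in `x` direction on which a nonzero polynomial vanishes identically. -/
theorem card_onXLine_eq_zero_le {f : F[X][X][X]} (hf : f ≠ 0) :
    Nat.card {v : F × F // onXLine v.1 v.2 f = 0} ≤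
      (f.natDegree + (flip f).natDegree + innerDegree f) * q := by
  classical
  set t := f.natDegree + (flip f).natDegree with ht
  -- A line on which `f` vanishes is a zero `(y, z)` of `g`. At most `deg_z f` planes `z = w`
  -- consist entirely of zeros of `g`; on any other, `innerDegree_onLine_le` with `u = 0` leaves at
  -- most `t` values of `y`.
  set g := f.leadingCoeff with hg
  have hg0 : g ≠ 0 := leadingCoeff_ne_zero.2 hf
  let W := Finset.univ.filter fun w : F => g.eval (C w) = 0
  have hW : W.card ≤ innerDegree f := by
    have : W.card ≤ g.natDegree := by
      by_contra! hlt
      refine hg0 (eq_zero_of_natDegree_lt_card_of_eval_eq_zero' g (W.image C) ?_ ?_)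
      · intro r hr
        obtain ⟨w, hw, rfl⟩ := Finset.mem_image.1 hr
        exact (Finset.mem_filter.1 hw).2
      · rwa [Finset.card_image_of_injective _ C_injective]
    exact this.trans (natDegree_coeff_le_innerDegree _ _)
  have hY : ∀ w : F, (Finset.univ.filter fun y : F => onXLine y w f = 0).card ≤
      t + if w ∈ W then q else 0 := by
    intro w
    split_ifs with hw
    · exact (Finset.card_le_univ _).trans (by omega)
    · have hgw : g.eval (C w) ≠ 0 := fun h => hw (Finset.mem_filter.2 ⟨Finset.mem_univ _, h⟩)
      have hdeg : (g.eval (C w)).natDegree ≤ t := by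
        refine le_trans (le_trans (le_of_eq ?_) (natDegree_coeff_le_innerDegree (onLine 0 w f)
          f.natDegree)) (innerDegree_onLine_le 0 w f)
        simp [onLine, hg]
      by_contra! hlt
      refine hgw (eq_zero_of_natDegree_lt_card_of_eval_eq_zero' _ _ (fun y hy => ?_)
        (hdeg.trans_lt hlt))
      have h0 := congrArg (coeff · f.natDegree) (Finset.mem_filter.1 hy).2
      have := onXLine_eq 0 w y f
      rw [zero_mul, zero_add] at this
      simp only [this] at h0
      simpa [onLine] using h0
  rw [Nat.card_eq_fintype_card, Fintype.card_subtype, Finset.card_filter, Fintype.sum_prod_type_right]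
  calc _ ≤ ∑ w : F, (t + if w ∈ W then q else 0) :=
        Finset.sum_le_sum fun w _ => by rw [← Finset.card_filter]; exact hY w
    _ = t * q + W.card * q := by
        rw [Finset.sum_add_distrib]
        simp [mul_comm]
    _ ≤ (t + innerDegree f) * q := by
        have h := Nat.mul_le_mul_right q hW
        have h' := add_mul t (innerDegree f) q
        omega

end Decoding

/-! ### Agreement testing in coordinates -/

section Agreement

variable {F : Type*} [Field F] [Fintype F]

local notation "q" => Fintype.card F

theorem card_onXLine_flip_eq_zero_le {f : F[X][X][X]} (hf : f ≠ 0) :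
    Nat.card {v : F × F // onXLine v.1 (-v.2) (flip f) = 0} ≤
      (f.natDegree + (flip f).natDegree + innerDegree f) * q := by
  have hf' : flip f ≠ 0 := fun h => hf (flip_injective (h.trans (map_zero flip).symm))
  have h1 := card_onXLine_eq_zero_le hf'
  rw [flip_flip] at h1
  have h2 : Nat.card {v : F × F // onXLine v.1 (-v.2) (flip f) = 0} ≤
      Nat.card {v : F × F // onXLine v.1 v.2 (flip f) = 0} := by
    refine Nat.card_le_card_of_injective (fun v => ⟨(v.1.1, -v.1.2), v.2⟩) fun v w h => ?_
    simp only [Subtype.mk.injEq, Prod.mk.injEq, neg_inj] at h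
    exact Subtype.ext (Prod.ext h.1 h.2)
  refine h2.trans (h1.trans (Nat.mul_le_mul_right _ ?_))
  have := innerDegree_flip_le f
  omega

theorem card_biUnion_antidiagonal (B : ℕ) :
    2 * ((Finset.range (B + 1)).biUnion Finset.HasAntidiagonal.antidiagonal : Finset (ℕ × ℕ)).card =
      (B + 1) * (B + 2) := by
  rw [Finset.card_biUnion]
  · induction B with
    | zero => simp
    | succ n ih =>
      rw [Finset.sum_range_succ, mul_add, ih, Finset.Nat.card_antidiagonal]
      ring
  · intro m _ n _ hmn
    rw [Function.onFun, Finset.disjoint_left]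
    intro v hv hv'
    rw [Finset.HasAntidiagonal.mem_antidiagonal] at hv hv'
    exact hmn (hv.symm.trans hv')

theorem rpow_third_facts {α ε : ℝ} (h0 : 0 ≤ α) (hε : 0 ≤ ε) (h : α < ε ^ 3) :
    0 ≤ α ^ ((1 : ℝ) / 3) ∧ (α ^ ((1 : ℝ) / 3)) ^ 3 = α ∧ α ^ ((1 : ℝ) / 3) < ε := by
  have h1 : 0 ≤ α ^ ((1 : ℝ) / 3) := Real.rpow_nonneg h0 _
  have h3 : (α ^ ((1 : ℝ) / 3)) ^ 3 = α := by
    rw [← Real.rpow_natCast, ← Real.rpow_mul h0]; norm_num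
  exact ⟨h1, h3, lt_of_pow_lt_pow_left₀ 3 hε (by rwa [h3])⟩

/-- Agreement testability of `C_{d, d}`. -/
theorem agreement_vertexCode {d : ℕ} (hd : 4 * d < q) {P Q : F × F × F → F}
    (hP : ∀ y z, (fun x => P (x, y, z)) ∈ reedSolomon F d)
    (hQ : ∀ x c, (fun y => Q (x, y, x * y + c)) ∈ reedSolomon F d) {α : ℝ}
    (hα : α * q ^ 3 = Nat.card {v // P v ≠ Q v})
    (hlt : α < (((q : ℝ) - 4 * d) / (5 * q)) ^ 3) :
    ∃ f ∈ vertexCode F d d,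
      (Nat.card {v : F × F // ∃ x, P (x, v.1, v.2) ≠ f (x, v.1, v.2)} +
        Nat.card {v : F × F // ∃ y, Q (v.1, y, v.1 * y + v.2) ≠ f (v.1, y, v.1 * y + v.2)} : ℝ) ≤
      4 * α ^ ((1 : ℝ) / 3) * (2 * q ^ 2) := by
  classical
  have hq : (0 : ℝ) < q := by exact_mod_cast Fintype.card_pos
  have hd' : (4 * d : ℝ) < q := by exact_mod_cast hd
  have hα0 : 0 ≤ α := by
    by_contra! h
    have : α * (q : ℝ) ^ 3 < 0 := mul_neg_of_neg_of_pos h (by positivity)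
    rw [hα] at this
    exact absurd this (not_lt.2 (Nat.cast_nonneg _))
  obtain ⟨hr0, hr3, hrlt⟩ := rpow_third_facts hα0
    (div_nonneg (by linarith) (by positivity)) hlt
  set r := α ^ ((1 : ℝ) / 3)
  set β := r * q with hβ
  have hβ0 : 0 ≤ β := by positivity
  have hβ3 : β ^ 3 = Nat.card {v // P v ≠ Q v} := by rw [← hα, hβ, mul_pow, hr3]
  -- This is `α < ε` rewritten; the `5` is `2 (1 + 3/2)`, from the degree bounds `β` and `3β/2` for
  -- `E`.
  have hβlt : 5 * β + 4 * d < q := by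
    rw [lt_div_iff₀ (by positivity)] at hrlt
    rw [hβ]; linarith
  set A := ⌊β⌋₊ with hA
  set B := ⌊3 / 2 * β⌋₊ with hB
  have hA1 : (A : ℝ) ≤ β := Nat.floor_le hβ0
  have hB1 : (B : ℝ) ≤ 3 / 2 * β := Nat.floor_le (by positivity)
  have hA2 : β < A + 1 := Nat.lt_floor_add_one _
  have hB2 : 3 / 2 * β < B + 1 := Nat.lt_floor_add_one _
  set D : Finset (ℕ × ℕ) := (Finset.range (B + 1)).biUnion Finset.HasAntidiagonal.antidiagonal with hD
  have hDc : (2 * D.card : ℝ) = (B + 1) * (B + 2) := by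
    exact_mod_cast card_biUnion_antidiagonal B
  have hDmem : ∀ v ∈ D, v.1 + v.2 ≤ B := by
    intro v hv
    simp only [hD, Finset.mem_biUnion, Finset.mem_range, Finset.HasAntidiagonal.mem_antidiagonal] at hv
    obtain ⟨n, hn, hv⟩ := hv
    omega
  -- The monomials `x^i y^j z^k` with `i ≤ A`, `j + k ≤ B` number `(A+1)(B+1)(B+2)/2`. This exceeds
  -- `β · (3β/2)² / 2 = 9β³/8`, hence the number `β³` of disagreements, and the `+ 1`s keep it
  -- strict when `β = 0`.
  set M := Finset.range (A + 1) ×ˢ D with hM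
  have hMcard : Nat.card {v // P v ≠ Q v} < M.card := by
    have : (Nat.card {v // P v ≠ Q v} : ℝ) < M.card := by
      rw [hM, Finset.card_product, Finset.card_range, ← hβ3]
      push_cast
      have h1 : (3 / 2 * β) ^ 2 ≤ 2 * D.card := by rw [hDc]; nlinarith
      have h2 : (0 : ℝ) < D.card := by
        have : (0 : ℝ) < 2 * D.card := by rw [hDc]; positivity
        linarith
      have h3 : β * D.card < (A + 1) * D.card := by gcongr
      have h4 : β * (3 / 2 * β) ^ 2 ≤ β * (2 * D.card) := by gcongr
      have h5 : 0 ≤ β ^ 3 := by positivity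
      nlinarith
    exact_mod_cast this
  obtain ⟨c, hE, hEv⟩ := exists_polyOf_eq_zero (fun v : {v // P v ≠ Q v} => v.1) hMcard
  set E := polyOf M c
  have hEA : E.natDegree ≤ A := natDegree_polyOf_le c fun m hm => by
    have := (Finset.mem_product.1 hm).1
    simp at this; omega
  have hEB : (flip E).natDegree ≤ B := natDegree_flip_polyOf_le c fun m hm =>
    hDmem _ (Finset.mem_product.1 hm).2
  have hEZ : innerDegree E ≤ B := innerDegree_polyOf_le c fun m hm => by
    have := hDmem _ (Finset.mem_product.1 hm).2
    omega
  have hlt1 : 2 * (A + B) + 4 * d < q := by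
    have : (2 * (A + B) + 4 * d : ℝ) < q := by linarith
    exact_mod_cast this
  have hlt2 : 2 * B < q := by omega
  obtain ⟨f, hf, hfP, hfQ⟩ := exists_codeword_of_mul_eq hE (by omega) (by omega) hP hQ (by
    intro x y z
    by_cases h : P (x, y, z) = Q (x, y, z)
    · rw [h]
    · rw [hEv ⟨(x, y, z), h⟩, zero_mul, zero_mul])
  refine ⟨f, hf, ?_⟩
  have hc1 : Nat.card {v : F × F // ∃ x, P (x, v.1, v.2) ≠ f (x, v.1, v.2)} ≤ (A + B + B) * q := by
    refine le_trans (Nat.card_le_card_of_injective (β := {v : F × F // onXLine v.1 v.2 E = 0})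
      (fun v => ⟨v.1, ?_⟩) fun v w h => ?_) ((card_onXLine_eq_zero_le hE).trans
        (Nat.mul_le_mul_right _ (by omega)))
    · by_contra hne
      obtain ⟨x, hx⟩ := v.2
      exact hx (hfP _ _ hne x).symm
    · exact Subtype.ext (Subtype.mk.inj h)
  have hc2 : Nat.card {v : F × F // ∃ y, Q (v.1, y, v.1 * y + v.2) ≠ f (v.1, y, v.1 * y + v.2)} ≤
      (A + B + B) * q := by
    refine le_trans (Nat.card_le_card_of_injective
      (β := {v : F × F // onXLine v.1 (-v.2) (flip E) = 0})
      (fun v => ⟨v.1, ?_⟩) fun v w h => ?_) ((card_onXLine_flip_eq_zero_le hE).trans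
        (Nat.mul_le_mul_right _ (by omega)))
    · by_contra hne
      obtain ⟨y, hy⟩ := v.2
      exact hy (hfQ _ _ hne y).symm
    · exact Subtype.ext (Subtype.mk.inj h)
  have hc1' : (Nat.card {v : F × F // ∃ x, P (x, v.1, v.2) ≠ f (x, v.1, v.2)} : ℝ) ≤
      (A + B + B) * q := by exact_mod_cast hc1
  have hc2' : (Nat.card {v : F × F //
      ∃ y, Q (v.1, y, v.1 * y + v.2) ≠ f (v.1, y, v.1 * y + v.2)} : ℝ) ≤
      (A + B + B) * q := by exact_mod_cast hc2
  have hsum : ((A : ℝ) + B + B) * q ≤ 4 * β * q := by gcongr; linarith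
  calc _ ≤ 4 * β * q + 4 * β * q := by linarith
    _ = _ := by rw [hβ]; ring

/-- Agreement testability of `RS ⊗ RS`. -/
theorem agreement_tensor {d : ℕ} (hd : 4 * d < q) {P Q : F × F → F}
    (hP : ∀ y, (fun x => P (x, y)) ∈ reedSolomon F d)
    (hQ : ∀ x, (fun y => Q (x, y)) ∈ reedSolomon F d) {α : ℝ}
    (hα : α * q ^ 2 = Nat.card {v // P v ≠ Q v})
    (hlt : α < (((q : ℝ) - 4 * d) / (5 * q)) ^ 3) :
    ∃ f : F × F → F, (∀ y, (fun x => f (x, y)) ∈ reedSolomon F d) ∧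
      (∀ x, (fun y => f (x, y)) ∈ reedSolomon F d) ∧
      (Nat.card {y : F // ∃ x, P (x, y) ≠ f (x, y)} +
        Nat.card {x : F // ∃ y, Q (x, y) ≠ f (x, y)} : ℝ) ≤
      4 * α ^ ((1 : ℝ) / 3) * (2 * q) := by
  classical
  have hq : (0 : ℝ) < q := by exact_mod_cast Fintype.card_pos
  have hd' : (4 * d : ℝ) < q := by exact_mod_cast hd
  have hα0 : 0 ≤ α := by
    by_contra! h
    have : α * (q : ℝ) ^ 2 < 0 := mul_neg_of_neg_of_pos h (by positivity)
    rw [hα] at this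
    exact absurd this (not_lt.2 (Nat.cast_nonneg _))
  obtain ⟨hr0, hr3, hrlt⟩ := rpow_third_facts hα0
    (div_nonneg (by linarith) (by positivity)) hlt
  set r := α ^ ((1 : ℝ) / 3)
  set β := r * q with hβ
  have hβ0 : 0 ≤ β := by positivity
  have hβlt : 5 * β + 4 * d < q := by
    rw [lt_div_iff₀ (by positivity)] at hrlt
    rw [hβ]; linarith
  have hr1 : r ≤ 1 := by
    have hd0 : (0 : ℝ) ≤ d := Nat.cast_nonneg d
    by_contra! h
    have : (q : ℝ) ≤ β := by rw [hβ]; nlinarith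
    linarith
  have hβ2 : (Nat.card {v // P v ≠ Q v} : ℝ) ≤ β ^ 2 := by
    -- In the plane there are `r³ q²` disagreements, fewer than `(A+1)²` because `r ≤ 1`. So degree
    -- `A` in each variable suffices, with the same `ε` and `ρ` as in the three-variable case.
    have h32 : r ^ 3 ≤ r ^ 2 := pow_le_pow_of_le_one hr0 hr1 (by norm_num)
    rw [← hα, hβ, mul_pow, ← hr3]
    exact mul_le_mul_of_nonneg_right h32 (by positivity)
  set A := ⌊β⌋₊ with hA
  have hA1 : (A : ℝ) ≤ β := Nat.floor_le hβ0
  have hA2 : β < A + 1 := Nat.lt_floor_add_one _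
  set M : Finset (ℕ × ℕ × ℕ) := Finset.range (A + 1) ×ˢ (Finset.range (A + 1) ×ˢ {0}) with hM
  have hMmem : ∀ m ∈ M, m.1 ≤ A ∧ m.2.1 ≤ A ∧ m.2.2 = 0 := by
    intro m hm
    simp only [hM, Finset.mem_product, Finset.mem_range, Finset.mem_singleton] at hm
    omega
  have hMcard : Nat.card {v // P v ≠ Q v} < M.card := by
    have : (Nat.card {v // P v ≠ Q v} : ℝ) < M.card := by
      simp only [hM, Finset.card_product, Finset.card_range, Finset.card_singleton]
      push_cast
      nlinarith
    exact_mod_cast this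
  obtain ⟨c, hE, hEv⟩ := exists_polyOf_eq_zero
    (fun v : {v // P v ≠ Q v} => (v.1.1, v.1.2, 0)) hMcard
  have hindep : ∀ x y z, eval3 x y z (polyOf M c) = eval3 x y 0 (polyOf M c) := by
    intro x y z
    rw [eval3_polyOf, eval3_polyOf]
    refine Finset.sum_congr rfl fun m hm => ?_
    rw [(hMmem m hm).2.2, pow_zero, pow_zero]
  set E := polyOf M c
  have hEA : E.natDegree ≤ A := natDegree_polyOf_le c fun m hm => by
    have := hMmem m hm; omega
  have hEB : (flip E).natDegree ≤ A := natDegree_flip_polyOf_le c fun m hm => by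
    have := hMmem m hm; omega
  have hEZ : innerDegree E ≤ 0 := innerDegree_polyOf_le c fun m hm => by
    have := hMmem m hm; omega
  have hlt1 : 5 * A + 4 * d < q := by
    have : (5 * A + 4 * d : ℝ) < q := by linarith
    exact_mod_cast this
  -- `P` and `Q` are extended to `F³` as functions constant in `z`; this makes them low-degree along
  -- both families of lines there.
  obtain ⟨f, hf, hfP, hfQ⟩ := exists_codeword_of_mul_eq (d := d) hE (by omega) (by omega)
    (P := fun v => P (v.1, v.2.1)) (Q := fun v => Q (v.1, v.2.1)) (fun y _ => hP y)
    (fun x _ => hQ x) (by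
      intro x y z
      by_cases h : P (x, y) = Q (x, y)
      · simp only [h]
      · rw [hindep, hEv ⟨(x, y), h⟩, zero_mul, zero_mul])
  have hdegE : ∀ y z, (onXLine y z E).natDegree < q := fun y z =>
    (natDegree_onXLine_le y z E).trans_lt (by omega)
  have hdegE' : ∀ y z, (onXLine y z (flip E)).natDegree < q := fun y z =>
    (natDegree_onXLine_le y z (flip E)).trans_lt (by omega)
  have hline : ∀ y z, onXLine y z E = onXLine y 0 E := fun y z =>
    eq_of_natDegree_lt_card_of_eval_eq _ _ Function.injective_id
      (fun x => by simp only [id, eval_onXLine]; exact hindep x y z) (max_lt (hdegE _ _) (hdegE _ _))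
  have hline' : ∀ x z, onXLine x z (flip E) = onXLine x 0 (flip E) := fun x z =>
    eq_of_natDegree_lt_card_of_eval_eq _ _ Function.injective_id
      (fun y => by
        simp only [id, eval_onXLine, eval3_flip]
        rw [hindep, hindep _ _ (y * x - 0)]) (max_lt (hdegE' _ _) (hdegE' _ _))
  -- The set of bad lines is a cylinder over the bad `y`, so the count in `F²` may be divided by
  -- `q`.
  have hcount : ∀ g : F[X][X][X], (∀ y z, onXLine y z g = onXLine y 0 g) →
      Nat.card {v : F × F // onXLine v.1 v.2 g = 0} ≤ (2 * A) * q →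
      Nat.card {y : F // onXLine y 0 g = 0} ≤ 2 * A := by
    intro g hg hle
    have hinj : Nat.card ({y : F // onXLine y 0 g = 0} × F) ≤
        Nat.card {v : F × F // onXLine v.1 v.2 g = 0} := by
      refine Nat.card_le_card_of_injective (fun v => ⟨(v.1.1, v.2), (hg _ _).trans v.1.2⟩) ?_
      intro v w h
      simp only [Subtype.mk.injEq, Prod.mk.injEq] at h
      exact Prod.ext (Subtype.ext h.1) h.2
    rw [Nat.card_prod, Nat.card_eq_fintype_card (α := F)] at hinj
    exact Nat.le_of_mul_le_mul_right (hinj.trans hle) Fintype.card_pos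
  have hY := hcount E hline ((card_onXLine_eq_zero_le hE).trans
    (Nat.mul_le_mul_right _ (by omega)))
  have hX := hcount (flip E) hline' ((card_onXLine_eq_zero_le (fun h =>
    hE (flip_injective (h.trans (map_zero flip).symm)))).trans
    (Nat.mul_le_mul_right _ (by
      have := innerDegree_flip_le E
      rw [flip_flip]
      omega)))
  -- The codeword could still depend on `z`. But for fixed `x`, its restrictions to the
  -- second-family lines with parameters `z - x y` and `0` have degree at most `d` in `y`, and both
  -- equal `P` at all but `2 A` values of `y`; these are more than `d` points.
  have hfz : ∀ x y z, f (x, y, z) = f (x, y, x * y) := by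
    intro x y z
    obtain ⟨p, hp, hfp⟩ := mem_reedSolomon_iff.1 (hf.2 x (z - x * y))
    obtain ⟨p', hp', hfp'⟩ := mem_reedSolomon_iff.1 (hf.2 x 0)
    have : p = p' := by
      refine eq_of_natDegree_lt_card_of_eval_eq' p p'
        (Finset.univ.filter fun y : F => ¬ onXLine y 0 E = 0) (fun y' hy' => ?_) ?_
      · have hy'' : ∀ z, onXLine y' z E ≠ 0 := fun z => by
          rw [hline]; exact (Finset.mem_filter.1 hy').2
        rw [← hfp, ← hfp', hfP _ _ (hy'' _), hfP _ _ (hy'' _)]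
      · have h1 := Finset.card_filter_add_card_filter_not (s := Finset.univ)
          (fun y : F => onXLine y 0 E = 0)
        rw [Nat.card_eq_fintype_card, Fintype.card_subtype] at hY
        rw [Finset.card_univ] at h1
        omega
    have h1 := hfp y
    rw [this, ← hfp'] at h1
    simpa using h1
  refine ⟨fun v => f (v.1, v.2, v.1 * v.2), fun y => ?_, fun x => ?_, ?_⟩
  · have := hf.1 y 0
    simpa only [hfz _ _ 0] using this
  · simpa using hf.2 x 0
  have hc1 : Nat.card {y : F // ∃ x, P (x, y) ≠ f (x, y, x * y)} ≤ 2 * A := by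
    refine le_trans (Nat.card_le_card_of_injective (β := {y : F // onXLine y 0 E = 0})
      (fun v => ⟨v.1, ?_⟩) fun v w h => ?_) hY
    · by_contra hne
      obtain ⟨x, hx⟩ := v.2
      exact hx (by rw [← hfz x v.1 0, hfP _ _ hne x])
    · exact Subtype.ext (Subtype.mk.inj h)
  have hc2 : Nat.card {x : F // ∃ y, Q (x, y) ≠ f (x, y, x * y)} ≤ 2 * A := by
    refine le_trans (Nat.card_le_card_of_injective (β := {x : F // onXLine x 0 (flip E) = 0})
      (fun v => ⟨v.1, ?_⟩) fun v w h => ?_) hX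
    · by_contra hne
      obtain ⟨y, hy⟩ := v.2
      have := hfQ v.1 0 (by rwa [hline']) y
      rw [add_zero] at this
      exact hy this.symm
    · exact Subtype.ext (Subtype.mk.inj h)
  have hc1' : (Nat.card {y : F // ∃ x, P (x, y) ≠ f (x, y, x * y)} : ℝ) ≤ 2 * A := by
    exact_mod_cast hc1
  have hc2' : (Nat.card {x : F // ∃ y, Q (x, y) ≠ f (x, y, x * y)} : ℝ) ≤ 2 * A := by
    exact_mod_cast hc2
  calc _ ≤ 4 * β + 4 * β := by simp only; linarith
    _ = _ := by rw [hβ]; ring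

/-- A function on a product whose rows and columns are codewords lies in the tensor code. -/
theorem mem_tensorCode_reedSolomon_iff {d : ℕ} (hd : d < q) {f : F × F → F} :
    f ∈ tensorCode (reedSolomon F d) (reedSolomon F d) ↔
      (∀ y, (fun x => f (x, y)) ∈ reedSolomon F d) ∧ ∀ x, (fun y => f (x, y)) ∈ reedSolomon F d := by
  constructor
  · intro hf
    induction hf using Submodule.span_induction with
    | mem f hf =>
      obtain ⟨u, hu, v, hv, rfl⟩ := hf
      refine ⟨fun y => ?_, fun x => Submodule.smul_mem _ (u x) hv⟩
      simp only [mul_comm _ (v y)]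
      exact Submodule.smul_mem _ (v y) hu
    | zero => exact ⟨fun _ => zero_mem _, fun _ => zero_mem _⟩
    | add f g _ _ hf hg =>
      exact ⟨fun y => add_mem (hf.1 y) (hg.1 y), fun x => add_mem (hf.2 x) (hg.2 x)⟩
    | smul r f _ hf =>
      exact ⟨fun y => Submodule.smul_mem _ r (hf.1 y), fun x => Submodule.smul_mem _ r (hf.2 x)⟩
  · rintro ⟨h1, h2⟩
    obtain ⟨s, L, hL, hs⟩ := exists_interpolation (F := F) d hd
    have : f = ∑ i ∈ s, fun v => (L i).eval v.1 * f (i, v.2) := by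
      ext ⟨x, y⟩
      rw [hs _ (h1 y) x, Finset.sum_apply]
      exact Finset.sum_congr rfl fun i _ => mul_comm _ _
    rw [this]
    refine Submodule.sum_mem _ fun i hi => Submodule.subset_span ?_
    exact ⟨_, eval_mem_reedSolomon (hL i hi), _, h2 i, rfl⟩

end Agreement

/-! ### Cyclic orders on the indices -/

section Rotation

variable {k : ℕ}

/-- The position of `a` in the cyclic order that starts at `c + 1` and ends at `c`. -/
def rot (c a : Fin (k + 1)) : ℕ := (a - (c + 1) : Fin (k + 1))

theorem rot_injective (c : Fin (k + 1)) : Function.Injective (rot c) := fun a b h => by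
  simpa using Fin.ext h

theorem rot_self (c : Fin (k + 1)) : rot c c = k := by
  have : c - (c + 1) = -1 := by abel
  rw [rot, this, Fin.coe_neg_one]

theorem rot_succ_self (c : Fin (k + 1)) : rot c (c + 1) = 0 := by simp [rot]

theorem rot_le (c a : Fin (k + 1)) : rot c a ≤ k := Nat.lt_succ_iff.1 (Fin.is_lt _)

theorem rot_lt {c a : Fin (k + 1)} (h : a ≠ c) : rot c a < k :=
  (rot_le c a).lt_of_ne fun h' => h (rot_injective c (h'.trans (rot_self c).symm))

theorem rot_succ {c a : Fin (k + 1)} (h : a ≠ c) : rot c (a + 1) = rot c a + 1 := by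
  have h1 := rot_lt h
  have : a + 1 - (c + 1) = (a - (c + 1)) + 1 := by abel
  rw [rot, this, Fin.val_add_one_of_lt (Fin.lt_last_iff_ne_last.2 fun h => ?_)]
  · rfl
  · exact h1.ne (congrArg Fin.val h)

theorem succ_succ_ne (hk : 2 ≤ k) (i : Fin (k + 1)) : i + 1 + 1 ≠ i := by
  intro h
  have h1 : (1 + 1 : Fin (k + 1)) = 0 := by
    rw [add_assoc] at h
    simpa using h
  have h2 := congrArg Fin.val h1
  rw [Fin.val_add, Fin.val_one', Fin.val_zero, Nat.mod_eq_of_lt (by omega : 1 < k + 1),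
    Nat.mod_eq_of_lt (by omega)] at h2
  omega

end Rotation

/-! ### Matrices in the groups `K φ k c` and in their intersections -/

section Band

variable {F : Type*} [Field F] {φ : F[X]} {k : ℕ}

/-- Unipotent matrices, upper triangular with respect to the cyclic order starting at `c + 1`, whose
entries are multiples of the powers of `t` given by the distance to the diagonal. -/
def IsBand (c : Fin (k + 1)) (M : Matrix (Fin (k + 1)) (Fin (k + 1)) (AdjoinRoot φ)) : Prop :=
  ∀ a b, ∃ r : F, M a b = AdjoinRoot.of φ r * AdjoinRoot.root φ ^ (rot c b - rot c a) ∧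
    (rot c b < rot c a → r = 0) ∧ (a = b → r = 1)

theorem IsBand.one (c : Fin (k + 1)) :
    IsBand c (1 : Matrix (Fin (k + 1)) (Fin (k + 1)) (AdjoinRoot φ)) := by
  intro a b
  by_cases h : a = b
  · subst h
    exact ⟨1, by simp, by simp, by simp⟩
  · exact ⟨0, by simp [h], by simp, by simp [h]⟩

/-- Only intermediate indices between `a` and `b` contribute, and for those the distances to the
diagonal add up. -/
theorem IsBand.mul {c : Fin (k + 1)} {M N : Matrix (Fin (k + 1)) (Fin (k + 1)) (AdjoinRoot φ)}
    (hM : IsBand c M) (hN : IsBand c N) : IsBand c (M * N) := by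
  choose u hu hu0 hu1 using hM
  choose v hv hv0 hv1 using hN
  intro a b
  have hterm : ∀ m, ¬ (rot c a ≤ rot c m ∧ rot c m ≤ rot c b) → u a m * v m b = 0 := by
    intro m hm
    by_cases h : rot c m < rot c a
    · rw [hu0 a m h, zero_mul]
    · rw [hv0 m b (by omega), mul_zero]
  refine ⟨∑ m, u a m * v m b, ?_, fun h => ?_, fun h => ?_⟩
  · rw [Matrix.mul_apply, map_sum, Finset.sum_mul]
    refine Finset.sum_congr rfl fun m _ => ?_
    rw [hu, hv]
    by_cases hm : rot c a ≤ rot c m ∧ rot c m ≤ rot c b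
    · have : rot c b - rot c a = (rot c m - rot c a) + (rot c b - rot c m) := by omega
      rw [this, pow_add, map_mul]
      ring
    · rw [mul_mul_mul_comm, ← map_mul, hterm m hm, map_zero, zero_mul, zero_mul]
  · exact Finset.sum_eq_zero fun m _ => hterm m (by omega)
  · subst h
    rw [Finset.sum_eq_single a, hu1 a a rfl, hv1 a a rfl, mul_one]
    · intro m _ hm
      refine hterm m fun h => hm (rot_injective c ?_)
      omega
    · simp

variable {c : Fin (k + 1)} {M : Matrix (Fin (k + 1)) (Fin (k + 1)) (AdjoinRoot φ)}

theorem IsBand.apply_self (hM : IsBand c M) (a : Fin (k + 1)) : M a a = 1 := by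
  obtain ⟨r, h1, -, h2⟩ := hM a a
  simp [h1, h2]

theorem IsBand.apply_eq_zero (hM : IsBand c M) {a b : Fin (k + 1)} (h : rot c b < rot c a) :
    M a b = 0 := by
  obtain ⟨r, h1, h2, -⟩ := hM a b
  rw [h1, h2 h, map_zero, zero_mul]

theorem IsBand.apply_succ (hM : IsBand c M) {a : Fin (k + 1)} (h : a ≠ c) :
    ∃ r : F, M a (a + 1) = AdjoinRoot.of φ r * AdjoinRoot.root φ := by
  obtain ⟨r, h1, -, -⟩ := hM a (a + 1)
  refine ⟨r, ?_⟩
  rw [h1, rot_succ h, Nat.add_sub_cancel_left, pow_one]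

theorem IsBand.apply_succ_succ (hM : IsBand c M) {a : Fin (k + 1)} (h : a ≠ c) (h' : a + 1 ≠ c) :
    ∃ r : F, M a (a + 1 + 1) = AdjoinRoot.of φ r * AdjoinRoot.root φ ^ 2 := by
  obtain ⟨r, h1, -, -⟩ := hM a (a + 1 + 1)
  refine ⟨r, ?_⟩
  rw [h1, rot_succ h', rot_succ h, add_assoc, Nat.add_sub_cancel_left]

theorem IsBand.row_eq_zero (hM : IsBand c M) {b : Fin (k + 1)} (h : b ≠ c) : M c b = 0 :=
  hM.apply_eq_zero (by rw [rot_self]; exact rot_lt h)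

theorem IsBand.col_eq_zero (hM : IsBand c M) {a : Fin (k + 1)} (h : a ≠ c + 1) :
    M a (c + 1) = 0 := by
  refine hM.apply_eq_zero ?_
  rw [rot_succ_self]
  exact Nat.pos_of_ne_zero fun h' => h (rot_injective c (h'.trans (rot_succ_self c).symm))

variable [NeZero k]

/-- The matrix of an element of `G`. -/
def toMat (x : grp φ k) : Matrix (Fin (k + 1)) (Fin (k + 1)) (AdjoinRoot φ) := x.1.1

theorem toMat_mul (x y : grp φ k) : toMat (x * y) = toMat x * toMat y := rfl

theorem toMat_one : toMat (1 : grp φ k) = 1 := rfl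

theorem coe_h (i : Fin (k + 1)) (r : F) : toMat (h φ k i r) =
      1 + Matrix.single i (i + 1) (AdjoinRoot.of φ r * AdjoinRoot.root φ) := rfl

theorem grp_ext {x y : grp φ k}
    (hxy : toMat x = toMat y) : x = y :=
  Subtype.ext (Subtype.ext hxy)

theorem h_add (i : Fin (k + 1)) (r s : F) : h φ k i (r + s) = h φ k i r * h φ k i s := by
  refine grp_ext ?_
  have := Matrix.transvection_mul_transvection_same (i := i) (j := i + 1) (ne_succ i)
    (AdjoinRoot.of φ r * AdjoinRoot.root φ) (AdjoinRoot.of φ s * AdjoinRoot.root φ)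
  rw [coe_h, map_add, add_mul]
  exact this.symm

theorem h_zero (i : Fin (k + 1)) : h φ k i 0 = 1 := by
  refine grp_ext ?_
  rw [coe_h, toMat_one]
  simp

theorem h_neg (i : Fin (k + 1)) (r : F) : h φ k i (-r) = (h φ k i r)⁻¹ := by
  rw [eq_inv_iff_mul_eq_one, ← h_add, neg_add_cancel, h_zero]

theorem h_mem_K {i c : Fin (k + 1)} (hic : i ≠ c) (r : F) : h φ k i r ∈ K φ k c :=
  Subgroup.subset_closure ⟨i, r, hic, rfl⟩

theorem isBand_h {i c : Fin (k + 1)} (hic : i ≠ c) (r : F) :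
    IsBand c (toMat (h φ k i r)) := by
  rw [coe_h]
  intro a b
  by_cases hab : a = b
  · subst hab
    refine ⟨1, ?_, by simp, by simp⟩
    have : ¬ (i = a ∧ i + 1 = a) := fun h => ne_succ i (h.1.trans h.2.symm)
    simp [this]
  by_cases hi : i = a ∧ i + 1 = b
  · obtain ⟨rfl, rfl⟩ := hi
    refine ⟨r, ?_, ?_, fun h => absurd h hab⟩
    · simp [rot_succ hic, Matrix.one_apply_ne hab]
    · rw [rot_succ hic]; omega
  · exact ⟨0, by simp [hi, Matrix.one_apply_ne hab], by simp,
      fun h => absurd h hab⟩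

theorem isBand_of_mem_K {c : Fin (k + 1)} {x : grp φ k} (hx : x ∈ K φ k c) :
    IsBand c (toMat x) := by
  -- The inverse is carried along, so closure of band matrices under inversion need not be shown
  -- separately.
  suffices IsBand c (toMat x) ∧
      IsBand c (toMat x⁻¹) from this.1
  induction hx using Subgroup.closure_induction with
  | mem x hx =>
    obtain ⟨j, r, hj, rfl⟩ := hx
    exact ⟨isBand_h hj r, by rw [← h_neg]; exact isBand_h hj _⟩
  | one => exact ⟨IsBand.one c, by rw [inv_one]; exact IsBand.one c⟩
  | mul x y _ _ hx hy =>
    refine ⟨hx.1.mul hy.1, ?_⟩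
    rw [mul_inv_rev]
    exact hy.2.mul hx.2
  | inv x _ hx => exact ⟨hx.2, by rw [inv_inv]; exact hx.1⟩

theorem IsBand.row_pred_eq_zero {a b : Fin (k + 1)} (hM : IsBand (a + 1) M) (h : b ≠ a)
    (h' : b ≠ a + 1) : M a b = 0 := by
  refine hM.apply_eq_zero ?_
  have h1 := rot_succ (ne_succ a)
  rw [rot_self] at h1
  have h2 := rot_lt h'
  have h3 : rot (a + 1) b ≠ rot (a + 1) a := fun e => h (rot_injective _ e)
  omega

/-- The intersection of all `K c` is trivial. -/
theorem eq_one_of_forall_mem_K {x : grp φ k} (hx : ∀ c, x ∈ K φ k c) : x = 1 := by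
  refine grp_ext ?_
  rw [toMat_one]
  ext a b
  have hb := isBand_of_mem_K (hx a)
  by_cases hab : a = b
  · subst hab
    rw [hb.apply_self]; simp
  · rw [hb.row_eq_zero (Ne.symm hab)]
    simp [hab]

/-- The intersection of the `K c` with `c ≠ i` is the group of the `h i r`. -/
theorem exists_eq_h {i : Fin (k + 1)} {x : grp φ k} (hx : ∀ c, c ≠ i → x ∈ K φ k c) :
    ∃ r, x = h φ k i r := by
  have hb := fun c hc => isBand_of_mem_K (hx c hc)
  -- Each row `c ≠ i` is trivial by membership in `K φ k c`. Row `i` is controlled by `K φ k (i +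
  -- 1)`, in whose order `i` is second to last.
  obtain ⟨r, hr⟩ := (hb (i + 1) (ne_succ i).symm).apply_succ (ne_succ i)
  refine ⟨r, grp_ext ?_⟩
  rw [coe_h]
  ext a b
  rw [Matrix.add_apply, Matrix.single_apply]
  by_cases hab : a = b
  · subst hab
    have : ¬ (i = a ∧ i + 1 = a) := fun h => ne_succ i (h.1.trans h.2.symm)
    rw [(hb (i + 1) (ne_succ i).symm).apply_self]
    simp [this]
  rw [Matrix.one_apply_ne hab, zero_add]
  by_cases hai : a = i
  · subst hai
    by_cases hbi : b = a + 1
    · subst hbi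
      simp [hr]
    · rw [(hb (a + 1) (ne_succ a).symm).row_pred_eq_zero (Ne.symm hab) hbi]
      simp [Ne.symm hbi]
  · rw [(hb a hai).row_eq_zero (Ne.symm hab)]
    simp [Ne.symm hai]

theorem toMat_h_mul_h {i j : Fin (k + 1)} (h1 : i ≠ j + 1) (r s : F) :
    toMat (h φ k j s * h φ k i r) =
      1 + Matrix.single i (i + 1) (AdjoinRoot.of φ r * AdjoinRoot.root φ) +
        Matrix.single j (j + 1) (AdjoinRoot.of φ s * AdjoinRoot.root φ) := by
  rw [toMat_mul, coe_h, coe_h, mul_add, add_mul, add_mul,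
    Matrix.single_mul_single_of_ne _ _ _ _ h1.symm]
  simp only [mul_one, one_mul, add_zero]
  abel

theorem h_mul_h_comm {i j : Fin (k + 1)} (h1 : i ≠ j + 1) (h2 : j ≠ i + 1) (r s : F) :
    h φ k i r * h φ k j s = h φ k j s * h φ k i r :=
  grp_ext (by rw [toMat_h_mul_h h1, toMat_h_mul_h h2, add_right_comm])

/-- Nonadjacency puts `i + 1` and `j + 1` among the admissible `c`; these two leave one free entry
each in rows `i` and `j`. -/
theorem exists_eq_h_mul_h {i j : Fin (k + 1)} (hij : i ≠ j) (h1 : i ≠ j + 1) (h2 : j ≠ i + 1)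
    {x : grp φ k} (hx : ∀ c, c ≠ i → c ≠ j → x ∈ K φ k c) :
    ∃ r s, x = h φ k j s * h φ k i r := by
  have hb := fun c hc hc' => isBand_of_mem_K (hx c hc hc')
  have hi := hb (i + 1) (ne_succ i).symm h2.symm
  have hj := hb (j + 1) h1.symm (ne_succ j).symm
  obtain ⟨r, hr⟩ := hi.apply_succ (ne_succ i)
  obtain ⟨s, hs⟩ := hj.apply_succ (ne_succ j)
  refine ⟨r, s, grp_ext ?_⟩
  rw [toMat_h_mul_h h1]
  ext a b
  rw [Matrix.add_apply, Matrix.add_apply, Matrix.single_apply, Matrix.single_apply]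
  by_cases hab : a = b
  · subst hab
    have h3 : ¬ (i = a ∧ i + 1 = a) := fun h => ne_succ i (h.1.trans h.2.symm)
    have h4 : ¬ (j = a ∧ j + 1 = a) := fun h => ne_succ j (h.1.trans h.2.symm)
    rw [hi.apply_self]
    simp [h3, h4]
  rw [Matrix.one_apply_ne hab, zero_add]
  by_cases hai : a = i
  · subst hai
    by_cases hbi : b = a + 1
    · subst hbi
      simp [hr, hij.symm]
    · rw [hi.row_pred_eq_zero (Ne.symm hab) hbi]
      simp [Ne.symm hbi, hij.symm]
  by_cases haj : a = j
  · subst haj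
    by_cases hbj : b = a + 1
    · subst hbj
      simp [hs, hij]
    · rw [hj.row_pred_eq_zero (Ne.symm hab) hbj]
      simp [Ne.symm hbj, hij]
  · rw [(hb a hai haj).row_eq_zero (Ne.symm hab)]
    simp [Ne.symm hai, Ne.symm haj]

end Band

/-! ### Adjacent colors: the Heisenberg group -/

section Heisenberg

variable {F : Type*} [Field F] (φ : F[X]) {k : ℕ} [NeZero k]

/-- The matrix `I + x t e_{i,i+1} + y t e_{i+1,i+2} + z t² e_{i,i+2}`. -/
noncomputable def heisMatrix (i : Fin (k + 1)) (x y z : F) :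
    Matrix (Fin (k + 1)) (Fin (k + 1)) (AdjoinRoot φ) :=
  1 + Matrix.single i (i + 1) (AdjoinRoot.of φ x * AdjoinRoot.root φ) +
    Matrix.single (i + 1) (i + 1 + 1) (AdjoinRoot.of φ y * AdjoinRoot.root φ) +
    Matrix.single i (i + 1 + 1) (AdjoinRoot.of φ z * AdjoinRoot.root φ ^ 2)

theorem heisMatrix_mul (hk : 2 ≤ k) (i : Fin (k + 1)) (x y z x' y' z' : F) :
    heisMatrix φ i x y z * heisMatrix φ i x' y' z' =
      heisMatrix φ i (x + x') (y + y') (z + z' + x * y') := by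
  have h1 := (ne_succ i).symm
  have h2 := (ne_succ (i + 1)).symm
  have h3 := succ_succ_ne hk i
  simp only [heisMatrix, mul_add, add_mul, mul_one, one_mul, Matrix.single_mul_single_same,
    Matrix.single_mul_single_of_ne _ _ _ _ h1, Matrix.single_mul_single_of_ne _ _ _ _ h2,
    Matrix.single_mul_single_of_ne _ _ _ _ h3, map_add, map_mul, Matrix.single_add, add_zero]
  have : AdjoinRoot.of φ x * AdjoinRoot.root φ * (AdjoinRoot.of φ y' * AdjoinRoot.root φ) =
      AdjoinRoot.of φ x * AdjoinRoot.of φ y' * AdjoinRoot.root φ ^ 2 := by ring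
  rw [this]
  abel

theorem coe_h_eq_heisMatrix (i : Fin (k + 1)) (r : F) :
    toMat (h φ k i r) = heisMatrix φ i r 0 0 := by
  simp [coe_h, heisMatrix]

theorem coe_h_succ_eq_heisMatrix (i : Fin (k + 1)) (r : F) :
    toMat (h φ k (i + 1) r) = heisMatrix φ i 0 r 0 := by
  simp [coe_h, heisMatrix]

/-- The element of `⟨H_i, H_{i+1}⟩` with matrix `heisMatrix φ i x y z`. -/
noncomputable def heis (i : Fin (k + 1)) (x y z : F) : grp φ k :=
  -- The commutator produces exactly the `z t²` entry. The last two factors are ordered so as to add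
  -- no cross term to it.
  h φ k i 1 * h φ k (i + 1) z * (h φ k i (-1) * h φ k (i + 1) (-z)) *
    (h φ k (i + 1) y * h φ k i x)

theorem coe_heis (hk : 2 ≤ k) (i : Fin (k + 1)) (x y z : F) :
    toMat (heis φ i x y z) = heisMatrix φ i x y z := by
  simp only [heis, toMat_mul, coe_h_succ_eq_heisMatrix]
  simp only [coe_h_eq_heisMatrix, heisMatrix_mul φ hk]
  congr 1 <;> ring

theorem heis_mul_h (hk : 2 ≤ k) (i : Fin (k + 1)) (x y z a : F) :
    heis φ i x y z * h φ k i a = heis φ i (x + a) y z := by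
  refine grp_ext ?_
  rw [coe_heis φ hk, toMat_mul, coe_heis φ hk,
    coe_h_eq_heisMatrix, heisMatrix_mul φ hk]
  congr 1 <;> ring

theorem heis_mul_h_succ (hk : 2 ≤ k) (i : Fin (k + 1)) (x y z b : F) :
    heis φ i x y z * h φ k (i + 1) b = heis φ i x (y + b) (z + x * b) := by
  refine grp_ext ?_
  rw [coe_heis φ hk, toMat_mul, coe_heis φ hk,
    coe_h_succ_eq_heisMatrix, heisMatrix_mul φ hk]
  congr 1 <;> ring

theorem heis_mem_K {i c : Fin (k + 1)} (h1 : c ≠ i) (h2 : c ≠ i + 1) (x y z : F) :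
    heis φ i x y z ∈ K φ k c := by
  unfold heis
  refine mul_mem (mul_mem (mul_mem ?_ ?_) (mul_mem ?_ ?_)) (mul_mem ?_ ?_) <;>
  first
  | exact h_mem_K h1.symm _
  | exact h_mem_K h2.symm _

theorem exists_eq_heis (hk : 2 ≤ k) {i : Fin (k + 1)} {g : grp φ k}
    (hg : ∀ c, c ≠ i → c ≠ i + 1 → g ∈ K φ k c) : ∃ x y z, heis φ i x y z = g := by
  have hb := fun c hc hc' => isBand_of_mem_K (hg c hc hc')
  have h1 := (ne_succ i).symm
  have h2 := (ne_succ (i + 1)).symm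
  have h3 := succ_succ_ne hk i
  have h0 := hb (i + 1 + 1) h3 h2
  obtain ⟨x, hx⟩ := h0.apply_succ h3.symm
  obtain ⟨y, hy⟩ := h0.apply_succ h2.symm
  obtain ⟨z, hz⟩ := h0.apply_succ_succ h3.symm h2.symm
  refine ⟨x, y, z, grp_ext ?_⟩
  rw [coe_heis φ hk, heisMatrix]
  ext a b
  simp only [Matrix.add_apply, Matrix.single_apply]
  by_cases hab : a = b
  · subst hab
    have e1 : ¬ (i = a ∧ i + 1 = a) := fun h => h1 (h.2.trans h.1.symm)
    have e2 : ¬ (i + 1 = a ∧ i + 1 + 1 = a) := fun h => h2 (h.2.trans h.1.symm)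
    have e3 : ¬ (i = a ∧ i + 1 + 1 = a) := fun h => h3 (h.2.trans h.1.symm)
    rw [h0.apply_self]
    simp [e1, e2, e3]
  rw [Matrix.one_apply_ne hab, zero_add]
  -- Membership in `K φ k (b - 1)` makes column `b` trivial, since `b` comes first in its order.
  have hcol : b ≠ i + 1 → b ≠ i + 1 + 1 →
      toMat g a b = 0 := by
    intro hb1 hb2
    have hbb : b - 1 + 1 = b := sub_add_cancel b 1
    have := (hb (b - 1) (fun e => hb1 (by rw [← hbb, e])) fun e => hb2 (by rw [← hbb, e])).col_eq_zero
      (a := a) (by rwa [hbb])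
    rwa [hbb] at this
  by_cases hai : a = i
  · subst hai
    by_cases hb1 : b = a + 1
    · subst hb1
      simp [hx, h1, h2]
    by_cases hb2 : b = a + 1 + 1
    · subst hb2
      simp [hz, h1, h2.symm]
    · rw [hcol hb1 hb2]
      simp [Ne.symm hb1, Ne.symm hb2]
  by_cases hai1 : a = i + 1
  · subst hai1
    by_cases hb2 : b = i + 1 + 1
    · subst hb2
      simp [hy, h1.symm]
    · rw [hcol (Ne.symm hab) hb2]
      simp [h1.symm, Ne.symm hb2]
  · rw [(hb a hai hai1).row_eq_zero (Ne.symm hab)]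
    simp [Ne.symm hai, Ne.symm hai1]

variable {φ}

/-- The coordinates of a group element are the scalars in front of powers of `t`; they are well
defined because `t` is nonzero in a field. -/
theorem of_mul_root_pow_injective [Fact (Irreducible φ)] (ht : AdjoinRoot.root φ ≠ 0) (n : ℕ) :
    Function.Injective fun r : F => AdjoinRoot.of φ r * AdjoinRoot.root φ ^ n := fun _ _ hrs =>
  (AdjoinRoot.of φ).injective (mul_right_cancel₀ (pow_ne_zero n ht) hrs)

theorem h_mul_h_injective [Fact (Irreducible φ)] (ht : AdjoinRoot.root φ ≠ 0)
    {i j : Fin (k + 1)} (hij : i ≠ j) (h1 : i ≠ j + 1) {r s r' s' : F}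
    (he : h φ k j s * h φ k i r = h φ k j s' * h φ k i r') : r = r' ∧ s = s' := by
  have hM := congrArg toMat he
  rw [toMat_h_mul_h h1, toMat_h_mul_h h1] at hM
  have e1 := congrFun (congrFun hM i) (i + 1)
  have e2 := congrFun (congrFun hM j) (j + 1)
  simp only [Matrix.add_apply, Matrix.single_apply, hij, hij.symm, false_and, and_self, if_true,
    if_false, add_zero, add_right_inj] at e1 e2
  exact ⟨of_mul_root_pow_injective ht 1 (by simpa using e1),
    of_mul_root_pow_injective ht 1 (by simpa using e2)⟩

theorem heis_injective [Fact (Irreducible φ)] (ht : AdjoinRoot.root φ ≠ 0) (hk : 2 ≤ k)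
    (i : Fin (k + 1)) {x y z x' y' z' : F} (he : heis φ i x y z = heis φ i x' y' z') :
    x = x' ∧ y = y' ∧ z = z' := by
  have h1 := (ne_succ i).symm
  have h2 := (ne_succ (i + 1)).symm
  have h3 := succ_succ_ne hk i
  have hM : heisMatrix φ i x y z = heisMatrix φ i x' y' z' := by
    rw [← coe_heis φ hk, he, coe_heis φ hk]
  have e1 := congrFun (congrFun hM i) (i + 1)
  have e2 := congrFun (congrFun hM (i + 1)) (i + 1 + 1)
  have e3 := congrFun (congrFun hM i) (i + 1 + 1)
  simp only [heisMatrix, Matrix.add_apply, Matrix.single_apply] at e1 e2 e3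
  simp only [h1, h2, h1.symm, h2.symm, and_true, and_false, and_self,
    if_true, if_false, add_zero, add_right_inj] at e1 e2 e3
  exact ⟨of_mul_root_pow_injective ht 1 (by simpa using e1),
    of_mul_root_pow_injective ht 1 (by simpa using e2),
    of_mul_root_pow_injective ht 2 (by simpa using e3)⟩

end Heisenberg

/-! ### Faces of the coset complex and their codes in terms of group elements -/

section Faces

variable {F : Type*} [Field F] {φ : F[X]} {k : ℕ} [NeZero k]

theorem card_topFace (g : grp φ k) : (topFace (K φ k) g).card = k + 1 := by simp [topFace]

theorem topFace_mem_complex (g : grp φ k) : topFace (K φ k) g ∈ complex φ k :=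
  ⟨g, fun _ hv => mem_topFace.1 hv⟩

theorem exists_subset_topFace {t : Finset (CosetVertex (K φ k))} (ht : t ∈ complex φ k) :
    ∃ g, t ⊆ topFace (K φ k) g :=
  ht.imp fun _ hg v hv => mem_topFace.2 (hg v hv)

theorem mem_complex_of_subset_topFace {t : Finset (CosetVertex (K φ k))} {g : grp φ k}
    (ht : t ⊆ topFace (K φ k) g) : t ∈ complex φ k :=
  ⟨g, fun _ hv => mem_topFace.1 (ht hv)⟩

theorem exists_eq_topFace {t : Finset (CosetVertex (K φ k))} (ht : t ∈ complex φ k)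
    (hc : t.card = k + 1) : ∃ g, t = topFace (K φ k) g := by
  obtain ⟨g, hg⟩ := exists_subset_topFace ht
  exact ⟨g, Finset.eq_of_subset_of_card_le hg (by rw [card_topFace, hc])⟩

/-- The facet of `topFace g` without the vertex of color `c`. -/
noncomputable def facet (g : grp φ k) (c : Fin (k + 1)) : Finset (CosetVertex (K φ k)) :=
  (topFace (K φ k) g).filter fun v => v.1 ≠ c

theorem mem_facet {g : grp φ k} {c : Fin (k + 1)} {v : CosetVertex (K φ k)} :
    v ∈ facet g c ↔ v.2 = (g : grp φ k ⧸ K φ k v.1) ∧ v.1 ≠ c := by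
  rw [facet, Finset.mem_filter, mem_topFace]

theorem facet_subset (g : grp φ k) (c : Fin (k + 1)) : facet g c ⊆ topFace (K φ k) g :=
  Finset.filter_subset _ _

theorem not_mem_color_facet (g : grp φ k) (c : Fin (k + 1)) : c ∉ color (facet g c) := by
  intro h
  obtain ⟨v, hv, rfl⟩ := Finset.mem_image.1 h
  exact (mem_facet.1 hv).2 rfl

theorem mem_color_facet (g : grp φ k) {c c' : Fin (k + 1)} (h : c' ≠ c) :
    c' ∈ color (facet g c) :=
  Finset.mem_image.2 ⟨⟨c', g⟩, mem_facet.2 ⟨rfl, h⟩, rfl⟩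

open Classical in
theorem facet_eq_erase (g : grp φ k) (c : Fin (k + 1)) :
    facet g c = (topFace (K φ k) g).erase ⟨c, g⟩ := by
  ext ⟨c', x⟩
  rw [mem_facet, Finset.mem_erase, mem_topFace]
  constructor
  · rintro ⟨h1, h2⟩
    exact ⟨fun h => h2 (congrArg Sigma.fst h), h1⟩
  · rintro ⟨h1, h2⟩
    refine ⟨h2, ?_⟩
    rintro rfl
    exact h1 (by simp only at h2; rw [h2])

theorem card_facet (g : grp φ k) (c : Fin (k + 1)) : (facet g c).card = k := by
  classical
  rw [facet_eq_erase, Finset.card_erase_of_mem (mem_topFace.2 rfl), card_topFace,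
    Nat.add_sub_cancel]

theorem subset_facet {t : Finset (CosetVertex (K φ k))} {g : grp φ k} {c : Fin (k + 1)}
    (hg : t ⊆ topFace (K φ k) g) (hc : c ∉ color t) : t ⊆ facet g c := fun _ hv =>
  mem_facet.2 ⟨mem_topFace.1 (hg hv), fun h => hc (h ▸ Finset.mem_image_of_mem _ hv)⟩

theorem exists_eq_facet {t : Finset (CosetVertex (K φ k))} (ht : t ∈ complex φ k)
    (hc : t.card = k) : ∃ g c, t = facet g c := by
  obtain ⟨g, hg⟩ := exists_subset_topFace ht
  have : ∃ c, c ∉ color t := by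
    by_contra! h
    have h1 : color t = Finset.univ := Finset.eq_univ_iff_forall.2 h
    have h2 : (color t).card ≤ t.card := Finset.card_image_le
    rw [h1, Finset.card_univ, Fintype.card_fin] at h2
    omega
  obtain ⟨c, hct⟩ := this
  exact ⟨g, c, Finset.eq_of_subset_of_card_le (subset_facet hg hct) (by rw [card_facet, hc])⟩

/-- The top faces above `t` thus form a coset of the intersection of the `K φ k c` over the colors
of `t`. -/
theorem subset_topFace_iff {t : Finset (CosetVertex (K φ k))} {g g' : grp φ k}
    (hg : t ⊆ topFace (K φ k) g) :
    t ⊆ topFace (K φ k) g' ↔ ∀ c ∈ color t, g⁻¹ * g' ∈ K φ k c := by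
  constructor
  · intro hg' c hc
    obtain ⟨v, hv, rfl⟩ := Finset.mem_image.1 hc
    rw [← QuotientGroup.eq, ← mem_topFace.1 (hg hv), ← mem_topFace.1 (hg' hv)]
  · intro h v hv
    rw [mem_topFace, mem_topFace.1 (hg hv), QuotientGroup.eq]
    exact h _ (Finset.mem_image_of_mem _ hv)

theorem topFace_injective : Function.Injective (topFace (K φ k)) := by
  intro g g' h
  have h1 := (subset_topFace_iff (g := g) (g' := g') subset_rfl).1 h.subset
  rw [← inv_mul_eq_one]
  refine eq_one_of_forall_mem_K fun c => h1 c ?_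
  exact Finset.mem_image.2 ⟨⟨c, g⟩, mem_topFace.2 rfl, rfl⟩

theorem facet_subset_topFace_iff {g g' : grp φ k} {c : Fin (k + 1)} :
    facet g c ⊆ topFace (K φ k) g' ↔ ∃ r, g' = g * h φ k c r := by
  rw [subset_topFace_iff (facet_subset g c)]
  constructor
  · intro h
    obtain ⟨r, hr⟩ := exists_eq_h fun c' hc' => h c' (mem_color_facet g hc')
    exact ⟨r, by rw [← hr, mul_inv_cancel_left]⟩
  · rintro ⟨r, rfl⟩ c' hc'
    rw [inv_mul_cancel_left]
    refine h_mem_K ?_ r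
    rintro rfl
    exact not_mem_color_facet g c hc'

theorem facet_eq_facet_iff {g g' : grp φ k} {c : Fin (k + 1)} :
    facet g c = facet g' c ↔ ∃ r, g' = g * h φ k c r := by
  rw [← facet_subset_topFace_iff]
  refine ⟨fun h => h ▸ facet_subset g' c, fun h => ?_⟩
  exact Finset.eq_of_subset_of_card_le (subset_facet h (not_mem_color_facet g c))
    (by rw [card_facet, card_facet])

theorem mem_faceCode_iff {d : ℕ} {s : Finset (CosetVertex (K φ k))}
    {f : star (complex φ k) s k → F} :
    f ∈ faceCode φ k d s ↔ ∀ (c : Fin (k + 1)) (hc : c ∉ color s) (g : grp φ k)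
      (hg : s ⊆ topFace (K φ k) g),
      (fun a : F => f ⟨topFace (K φ k) (g * h φ k c a), topFace_mem_star hc hg a⟩) ∈
        reedSolomon F d := by
  constructor
  · intro hf c hc g hg
    exact hf (facet g c) (mem_complex_of_subset_topFace (facet_subset g c)) (card_facet g c)
      (subset_facet hg hc) c (not_mem_color_facet g c) g (facet_subset g c)
  · intro hf t ht htc hst c hc g hg
    exact hf c (fun h => hc (Finset.image_subset_image hst h)) g (hst.trans hg)

theorem not_mem_color_iff {s : Finset (CosetVertex (K φ k))} {i j : Fin (k + 1)}
    (hs : color s = Finset.univ \ {i, j}) {c : Fin (k + 1)} :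
    c ∉ color s ↔ c = i ∨ c = j := by
  rw [hs]
  simp [or_iff_not_imp_left]

end Faces

/-! ### Transfer from link coordinates to the complex -/

section Charts

variable {F : Type*} [Field F] {φ : F[X]} {k : ℕ} [NeZero k]

/-- Coordinates on the intersection of the `K c`, `c ≠ i, j`, in which right multiplication by
`h i a` and `h j a` is given by `act₁` and `act₂`, with orbits the fibers of `π₁` and `π₂`. -/
structure LinkChart (φ : F[X]) (i j : Fin (k + 1)) (P L₁ L₂ : Type*) where
  m : P → grp φ k
  injective_m : Function.Injective m
  mem_K : ∀ p c, c ≠ i → c ≠ j → m p ∈ K φ k c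
  exists_eq : ∀ g, (∀ c, c ≠ i → c ≠ j → g ∈ K φ k c) → ∃ p, m p = g
  act₁ : P → F → P
  act₂ : P → F → P
  m_act₁ : ∀ p a, m (act₁ p a) = m p * h φ k i a
  m_act₂ : ∀ p a, m (act₂ p a) = m p * h φ k j a
  π₁ : P → L₁
  π₂ : P → L₂
  surjective_π₁ : Function.Surjective π₁
  surjective_π₂ : Function.Surjective π₂
  π₁_eq_iff : ∀ p p', π₁ p = π₁ p' ↔ ∃ a, p' = act₁ p a
  π₂_eq_iff : ∀ p p', π₂ p = π₂ p' ↔ ∃ a, p' = act₂ p a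

variable {P L₁ L₂ : Type*} {i j : Fin (k + 1)} (χ : LinkChart φ i j P L₁ L₂)
  {s : Finset (CosetVertex (K φ k))} {g₀ : grp φ k}

namespace LinkChart

/-- The top-dimensional face with given coordinates. -/
noncomputable def face (g₀ : grp φ k) (p : P) : Finset (CosetVertex (K φ k)) := topFace (K φ k) (g₀ * χ.m p)

theorem subset_face (hs : color s = Finset.univ \ {i, j}) (hg₀ : s ⊆ topFace (K φ k) g₀) (p : P) :
    s ⊆ χ.face g₀ p := by
  rw [face, subset_topFace_iff hg₀]
  intro c hc
  rw [inv_mul_cancel_left]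
  rw [hs] at hc
  simp only [Finset.mem_sdiff, Finset.mem_univ, Finset.mem_insert, Finset.mem_singleton,
    true_and, not_or] at hc
  exact χ.mem_K p c hc.1 hc.2

theorem exists_face_eq (hs : color s = Finset.univ \ {i, j}) (hg₀ : s ⊆ topFace (K φ k) g₀)
    {g : grp φ k} (hg : s ⊆ topFace (K φ k) g) : ∃ p, g₀ * χ.m p = g := by
  obtain ⟨p, hp⟩ := χ.exists_eq (g₀⁻¹ * g) fun c hci hcj =>
    (subset_topFace_iff hg₀).1 hg c (by simp [hs, hci, hcj])
  exact ⟨p, by rw [hp, mul_inv_cancel_left]⟩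

/-- The dimension `n` is kept apart from `k` because the edges of the link are indexed by `s.card +
1`, which equals `k` only propositionally. -/
theorem face_mem_star (hs : color s = Finset.univ \ {i, j}) (hg₀ : s ⊆ topFace (K φ k) g₀)
    (p : P) {n : ℕ} (hn : n = k) : χ.face g₀ p ∈ star (complex φ k) s n :=
  ⟨⟨topFace_mem_complex _, by rw [hn]; exact card_topFace _⟩, χ.subset_face hs hg₀ p⟩

/-- The coordinates on the top-dimensional faces that contain `s`. -/
noncomputable def equivStar (hs : color s = Finset.univ \ {i, j})
    (hg₀ : s ⊆ topFace (K φ k) g₀) {n : ℕ} (hn : n = k) : P ≃ star (complex φ k) s n :=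
  Equiv.ofBijective (fun p => ⟨χ.face g₀ p, χ.face_mem_star hs hg₀ p hn⟩) (by
    constructor
    · intro p p' h
      exact χ.injective_m (mul_left_cancel (topFace_injective (Subtype.mk.inj h)))
    · rintro ⟨t, ⟨ht, htc⟩, hst⟩
      obtain ⟨g, rfl⟩ := exists_eq_topFace ht (by rw [htc, hn])
      obtain ⟨p, rfl⟩ := χ.exists_face_eq hs hg₀ hst
      exact ⟨p, rfl⟩)

theorem comp_equivStar_mem_faceCode_iff (hs : color s = Finset.univ \ {i, j})
    (hg₀ : s ⊆ topFace (K φ k) g₀) {d : ℕ} {f : P → F} :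
    f ∘ (χ.equivStar hs hg₀ rfl).symm ∈ faceCode φ k d s ↔
      (∀ p, (fun a => f (χ.act₁ p a)) ∈ reedSolomon F d) ∧
      ∀ p, (fun a => f (χ.act₂ p a)) ∈ reedSolomon F d := by
  have key : ∀ (c : Fin (k + 1)) (act : P → F → P)
      (_ : ∀ p a, χ.m (act p a) = χ.m p * h φ k c a) (hc : c ∉ color s) (p : P)
      (hg : s ⊆ topFace (K φ k) (g₀ * χ.m p)) (a : F),
      (f ∘ (χ.equivStar hs hg₀ rfl).symm) ⟨topFace (K φ k) (g₀ * χ.m p * h φ k c a),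
        topFace_mem_star hc hg a⟩ = f (act p a) := by
    intro c act hact hc p hg a
    refine congrArg f ((Equiv.symm_apply_eq _).2 (Subtype.ext ?_))
    change topFace (K φ k) (g₀ * χ.m p * h φ k c a) = topFace (K φ k) (g₀ * χ.m (act p a))
    rw [hact, mul_assoc]
  have hi : i ∉ color s := (not_mem_color_iff hs).2 (Or.inl rfl)
  have hj : j ∉ color s := (not_mem_color_iff hs).2 (Or.inr rfl)
  rw [mem_faceCode_iff]
  constructor
  · intro hf
    constructor
    · intro p
      have hp := χ.subset_face hs hg₀ p
      exact funext (key i χ.act₁ χ.m_act₁ hi p hp) ▸ hf i hi _ hp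
    · intro p
      have hp := χ.subset_face hs hg₀ p
      exact funext (key j χ.act₂ χ.m_act₂ hj p hp) ▸ hf j hj _ hp
  · rintro ⟨h1, h2⟩ c hc g hg
    obtain ⟨p, rfl⟩ := χ.exists_face_eq hs hg₀ hg
    obtain rfl | rfl := (not_mem_color_iff hs).1 hc
    · exact funext (key c χ.act₁ χ.m_act₁ hc p hg) ▸ h1 p
    · exact funext (key c χ.act₂ χ.m_act₂ hc p hg) ▸ h2 p

theorem codeIso (hs : color s = Finset.univ \ {i, j}) (hg₀ : s ⊆ topFace (K φ k) g₀) {d : ℕ}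
    {D : Submodule F (P → F)} (hD : ∀ f, f ∈ D ↔
      (∀ p, (fun a => f (χ.act₁ p a)) ∈ reedSolomon F d) ∧
      ∀ p, (fun a => f (χ.act₂ p a)) ∈ reedSolomon F d) :
    CodeIso (faceCode φ k d s) D :=
  ⟨(χ.equivStar hs hg₀ rfl).symm, fun f => by
    rw [χ.comp_equivStar_mem_faceCode_iff hs hg₀, hD]⟩

/-- Agreement testability at `s`, in coordinates. -/
theorem agreementTestable [Finite P] [Finite L₁] [Finite L₂] [Nonempty P] (hij : i ≠ j)
    (hs : color s = Finset.univ \ {i, j}) (hg₀ : s ⊆ topFace (K φ k) g₀) (hcard : s.card + 1 = k)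
    {d : ℕ} {ε : ℝ} {ρ : ℝ → ℝ} (hε : 0 < ε) (hρ : StrictMonoOn ρ (Set.Ici 0))
    (hρ0 : ∀ x, 0 ≤ x → 0 ≤ ρ x)
    (hagree : ∀ u v : P → F, (∀ p, (fun a => u (χ.act₁ p a)) ∈ reedSolomon F d) →
      (∀ p, (fun a => v (χ.act₂ p a)) ∈ reedSolomon F d) → ∀ α : ℝ,
      α * Nat.card P = Nat.card {p // u p ≠ v p} → α < ε →
      ∃ f : P → F, (∀ p, (fun a => f (χ.act₁ p a)) ∈ reedSolomon F d) ∧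
        (∀ p, (fun a => f (χ.act₂ p a)) ∈ reedSolomon F d) ∧
        (Nat.card {l // ∃ p, χ.π₁ p = l ∧ u p ≠ f p} +
          Nat.card {l // ∃ p, χ.π₂ p = l ∧ v p ≠ f p} : ℝ) ≤
          ρ α * (Nat.card L₁ + Nat.card L₂)) :
    AgreementTestable (complex φ k) k (faceCode φ k d) s ε ρ := by
  classical
  refine ⟨hε, hρ, hρ0, fun z hz α hα hαε => ?_⟩
  have hi : i ∉ color s := (not_mem_color_iff hs).2 (Or.inl rfl)
  have hj : j ∉ color s := (not_mem_color_iff hs).2 (Or.inr rfl)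
  have hmem : ∀ (c : Fin (k + 1)) (p : P), c ∉ color s →
      facet (g₀ * χ.m p) c ∈ star (complex φ k) s s.card := fun c p hc =>
    ⟨⟨mem_complex_of_subset_topFace (facet_subset _ _), by rw [card_facet, hcard]⟩,
      subset_facet (χ.subset_face hs hg₀ p) hc⟩
  -- The link is bipartite: its vertices are the facets above `s` missing `i` or missing `j`,
  -- corresponding to the fibers of `π₁` and `π₂`.
  let w₁ : P → star (complex φ k) s s.card := fun p => ⟨facet (g₀ * χ.m p) i, hmem i p hi⟩
  let w₂ : P → star (complex φ k) s s.card := fun p => ⟨facet (g₀ * χ.m p) j, hmem j p hj⟩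
  have hw₁ : ∀ p p', w₁ p = w₁ p' ↔ χ.π₁ p = χ.π₁ p' := by
    intro p p'
    rw [χ.π₁_eq_iff, Subtype.ext_iff, facet_eq_facet_iff]
    refine exists_congr fun a => ?_
    rw [mul_assoc, mul_right_inj, ← χ.m_act₁, χ.injective_m.eq_iff]
  have hw₂ : ∀ p p', w₂ p = w₂ p' ↔ χ.π₂ p = χ.π₂ p' := by
    intro p p'
    rw [χ.π₂_eq_iff, Subtype.ext_iff, facet_eq_facet_iff]
    refine exists_congr fun a => ?_
    rw [mul_assoc, mul_right_inj, ← χ.m_act₂, χ.injective_m.eq_iff]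
  have hw₁₂ : ∀ p p', w₁ p ≠ w₂ p' := by
    intro p p' h
    have h2 : j ∈ color (w₁ p).1 := mem_color_facet _ hij.symm
    rw [h] at h2
    exact not_mem_color_facet _ _ h2
  have hcover : ∀ t, (∃ p, w₁ p = t) ∨ ∃ p, w₂ p = t := by
    rintro ⟨t, ⟨ht, htc⟩, hst⟩
    obtain ⟨g, c, rfl⟩ := exists_eq_facet ht (by rw [htc, hcard])
    obtain ⟨p, rfl⟩ := χ.exists_face_eq hs hg₀ (hst.trans (facet_subset g c))
    have hc : c ∉ color s := fun h =>
      not_mem_color_facet _ c (Finset.image_subset_image hst h)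
    obtain rfl | rfl := (not_mem_color_iff hs).1 hc
    · exact Or.inl ⟨p, rfl⟩
    · exact Or.inr ⟨p, rfl⟩
  have hinc₁ : ∀ p p', (w₁ p).1 ⊆ χ.face g₀ p' → ∃ a, p' = χ.act₁ p a := by
    intro p p' h
    obtain ⟨a, ha⟩ := facet_subset_topFace_iff.1 h
    rw [mul_assoc, mul_right_inj, ← χ.m_act₁, χ.injective_m.eq_iff] at ha
    exact ⟨a, ha⟩
  have hinc₂ : ∀ p p', (w₂ p).1 ⊆ χ.face g₀ p' → ∃ a, p' = χ.act₂ p a := by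
    intro p p' h
    obtain ⟨a, ha⟩ := facet_subset_topFace_iff.1 h
    rw [mul_assoc, mul_right_inj, ← χ.m_act₂, χ.injective_m.eq_iff] at ha
    exact ⟨a, ha⟩
  have hstar : ∀ (t : Finset (CosetVertex (K φ k))) p, t ⊆ χ.face g₀ p →
      χ.face g₀ p ∈ star (complex φ k) t k :=
    fun t p h => ⟨⟨topFace_mem_complex _, card_topFace _⟩, h⟩
  have hcongr : ∀ (t t' : star (complex φ k) s s.card) (e : t = t') (y) (hy) (hy'),
      z t ⟨y, hy⟩ = z t' ⟨y, hy'⟩ := by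
    rintro t _ rfl y hy hy'
    rfl
  let u : P → F := fun p => z (w₁ p) ⟨χ.face g₀ p, hstar _ p (facet_subset _ _)⟩
  let v : P → F := fun p => z (w₂ p) ⟨χ.face g₀ p, hstar _ p (facet_subset _ _)⟩
  have hu' : ∀ p a (hy), u (χ.act₁ p a) = z (w₁ p) ⟨χ.face g₀ (χ.act₁ p a), hy⟩ := fun p a hy =>
    hcongr _ _ ((hw₁ _ _).2 ((χ.π₁_eq_iff _ _).2 ⟨a, rfl⟩).symm) _ _ _
  have hv' : ∀ p a (hy), v (χ.act₂ p a) = z (w₂ p) ⟨χ.face g₀ (χ.act₂ p a), hy⟩ := fun p a hy =>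
    hcongr _ _ ((hw₂ _ _).2 ((χ.π₂_eq_iff _ _).2 ⟨a, rfl⟩).symm) _ _ _
  have hface₁ : ∀ p a, topFace (K φ k) (g₀ * χ.m p * h φ k i a) = χ.face g₀ (χ.act₁ p a) := by
    intro p a; rw [face, χ.m_act₁, mul_assoc]
  have hface₂ : ∀ p a, topFace (K φ k) (g₀ * χ.m p * h φ k j a) = χ.face g₀ (χ.act₂ p a) := by
    intro p a; rw [face, χ.m_act₂, mul_assoc]
  have hu : ∀ p, (fun a => u (χ.act₁ p a)) ∈ reedSolomon F d := by
    intro p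
    have h1 := mem_faceCode_iff.1 (hz (w₁ p)) i (not_mem_color_facet _ _) _ (facet_subset _ _)
    have h2 : ∀ a, χ.face g₀ (χ.act₁ p a) ∈ star (complex φ k) (w₁ p).1 k := fun a => by
      rw [← hface₁]; exact topFace_mem_star (not_mem_color_facet _ _) (facet_subset _ _) a
    simp only [fun a => hu' p a (h2 a)]
    simpa only [hface₁] using h1
  have hv : ∀ p, (fun a => v (χ.act₂ p a)) ∈ reedSolomon F d := by
    intro p
    have h1 := mem_faceCode_iff.1 (hz (w₂ p)) j (not_mem_color_facet _ _) _ (facet_subset _ _)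
    have h2 : ∀ a, χ.face g₀ (χ.act₂ p a) ∈ star (complex φ k) (w₂ p).1 k := fun a => by
      rw [← hface₂]; exact topFace_mem_star (not_mem_color_facet _ _) (facet_subset _ _) a
    simp only [fun a => hv' p a (h2 a)]
    simpa only [hface₂] using h1
  have hval : ∀ t p (ht : t.1 ⊆ χ.face g₀ p),
      z t ⟨χ.face g₀ p, hstar _ p ht⟩ = u p ∨ z t ⟨χ.face g₀ p, hstar _ p ht⟩ = v p := by
    intro t p ht
    obtain ⟨p', rfl⟩ | ⟨p', rfl⟩ := hcover t
    · obtain ⟨a, rfl⟩ := hinc₁ _ _ ht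
      exact Or.inl (hu' _ _ _).symm
    · obtain ⟨a, rfl⟩ := hinc₂ _ _ ht
      exact Or.inr (hv' _ _ _).symm
  -- An edge of the link is a top face, whose star in dimension `k` is a single point. Disagreement
  -- on it is therefore inequality of two field elements.
  have hevent : ∀ p, (∃ (t t' : star (complex φ k) s s.card) (ht : t.1 ⊆ χ.face g₀ p)
      (ht' : t'.1 ⊆ χ.face g₀ p), restrict (k := k) ht (z t) ≠ restrict ht' (z t')) ↔
      u p ≠ v p := by
    intro p
    constructor
    · rintro ⟨t, t', ht, ht', hne⟩ huv
      refine hne (funext ?_)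
      rintro ⟨y, ⟨hy, hyc⟩, hpy⟩
      obtain rfl : χ.face g₀ p = y :=
        Finset.eq_of_subset_of_card_le hpy (by rw [hyc]; exact (card_topFace _).ge)
      have h1 := hval t p ht
      have h2 := hval t' p ht'
      rw [← huv, or_self] at h1 h2
      exact h1.trans h2.symm
    · intro huv
      refine ⟨w₁ p, w₂ p, facet_subset _ _, facet_subset _ _, fun he => huv ?_⟩
      exact congrFun he ⟨χ.face g₀ p, hstar _ p subset_rfl⟩
  have hα' : α * Nat.card P = Nat.card {p // u p ≠ v p} := by
    have h1 : (Nat.card P : ℝ) ≠ 0 := Nat.cast_ne_zero.2 Nat.card_pos.ne'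
    rw [hα, prob, ← Nat.card_congr (χ.equivStar hs hg₀ hcard), div_mul_cancel₀ _ h1]
    exact congrArg _ (Nat.card_congr ((χ.equivStar hs hg₀ hcard).subtypeEquiv
      fun p => (hevent p).symm)).symm
  obtain ⟨f, hf₁, hf₂, hf⟩ := hagree u v hu hv α hα' hαε
  refine ⟨f ∘ (χ.equivStar hs hg₀ rfl).symm,
    (χ.comp_equivStar_mem_faceCode_iff hs hg₀).2 ⟨hf₁, hf₂⟩, ?_⟩
  have hx : ∀ p hy, (f ∘ (χ.equivStar hs hg₀ rfl).symm) ⟨χ.face g₀ p, hy⟩ = f p := fun p hy =>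
    congrArg f ((Equiv.symm_apply_eq _).2 rfl)
  have hbad₁ : ∀ p, z (w₁ p) ≠ restrict (w₁ p).2.2 (f ∘ (χ.equivStar hs hg₀ rfl).symm) →
      ∃ p', χ.π₁ p' = χ.π₁ p ∧ u p' ≠ f p' := by
    intro p hp
    by_contra! hall
    refine hp (funext ?_)
    rintro ⟨y, ⟨hy, hyc⟩, hpy⟩
    obtain ⟨g, rfl⟩ := exists_eq_topFace hy hyc
    obtain ⟨p', rfl⟩ := χ.exists_face_eq hs hg₀ ((w₁ p).2.2.trans hpy)
    obtain ⟨a, rfl⟩ := hinc₁ _ _ hpy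
    have h1 := hall _ ((χ.π₁_eq_iff _ _).2 ⟨a, rfl⟩).symm
    exact (hu' p a _).symm.trans (h1.trans (hx _ _).symm)
  have hbad₂ : ∀ p, z (w₂ p) ≠ restrict (w₂ p).2.2 (f ∘ (χ.equivStar hs hg₀ rfl).symm) →
      ∃ p', χ.π₂ p' = χ.π₂ p ∧ v p' ≠ f p' := by
    intro p hp
    by_contra! hall
    refine hp (funext ?_)
    rintro ⟨y, ⟨hy, hyc⟩, hpy⟩
    obtain ⟨g, rfl⟩ := exists_eq_topFace hy hyc
    obtain ⟨p', rfl⟩ := χ.exists_face_eq hs hg₀ ((w₂ p).2.2.trans hpy)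
    obtain ⟨a, rfl⟩ := hinc₂ _ _ hpy
    have h1 := hall _ ((χ.π₂_eq_iff _ _).2 ⟨a, rfl⟩).symm
    exact (hv' p a _).symm.trans (h1.trans (hx _ _).symm)
  have hr₁ := Function.surjInv_eq χ.surjective_π₁
  have hr₂ := Function.surjInv_eq χ.surjective_π₂
  let e : L₁ ⊕ L₂ ≃ star (complex φ k) s s.card :=
    Equiv.ofBijective (Sum.elim (fun l => w₁ (Function.surjInv χ.surjective_π₁ l))
      fun l => w₂ (Function.surjInv χ.surjective_π₂ l)) (by
        constructor
        · rintro (l | l) (l' | l') hl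
          · have := (hw₁ _ _).1 hl
            rw [hr₁, hr₁] at this
            rw [this]
          · exact (hw₁₂ _ _ hl).elim
          · exact (hw₁₂ _ _ hl.symm).elim
          · have := (hw₂ _ _).1 hl
            rw [hr₂, hr₂] at this
            rw [this]
        · intro t
          obtain ⟨p, rfl⟩ | ⟨p, rfl⟩ := hcover t
          · exact ⟨Sum.inl (χ.π₁ p), (hw₁ _ _).2 (hr₁ _)⟩
          · exact ⟨Sum.inr (χ.π₂ p), (hw₂ _ _).2 (hr₂ _)⟩)
  have hle₁ : Nat.card {l // z (e (Sum.inl l)) ≠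
      restrict (e (Sum.inl l)).2.2 (f ∘ (χ.equivStar hs hg₀ rfl).symm)} ≤
      Nat.card {l // ∃ p, χ.π₁ p = l ∧ u p ≠ f p} :=
    Nat.card_le_card_of_injective (Subtype.map id fun l hl => by
      obtain ⟨p, hp, hne⟩ := hbad₁ _ hl
      exact ⟨p, hp.trans (hr₁ l), hne⟩) (Subtype.map_injective _ Function.injective_id)
  have hle₂ : Nat.card {l // z (e (Sum.inr l)) ≠
      restrict (e (Sum.inr l)).2.2 (f ∘ (χ.equivStar hs hg₀ rfl).symm)} ≤
      Nat.card {l // ∃ p, χ.π₂ p = l ∧ v p ≠ f p} :=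
    Nat.card_le_card_of_injective (Subtype.map id fun l hl => by
      obtain ⟨p, hp, hne⟩ := hbad₂ _ hl
      exact ⟨p, hp.trans (hr₂ l), hne⟩) (Subtype.map_injective _ Function.injective_id)
  have hL : (0 : ℝ) < Nat.card L₁ + Nat.card L₂ := by
    have : Nonempty L₁ := (inferInstance : Nonempty P).map χ.π₁
    have : 0 < Nat.card L₁ := Nat.card_pos
    positivity
  rw [prob, ← Nat.card_congr e, Nat.card_sum, Nat.cast_add, div_le_iff₀ hL]
  refine le_trans ?_ hf
  rw [← Nat.card_congr (e.subtypeEquiv (p := fun l => z (e l) ≠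
    restrict (e l).2.2 (f ∘ (χ.equivStar hs hg₀ rfl).symm)) fun _ => Iff.rfl),
    Nat.card_congr Equiv.subtypeSum, Nat.card_sum]
  exact_mod_cast add_le_add hle₁ hle₂

end LinkChart

end Charts

/-! ### The two charts and their consequences -/

section Instances

variable {F : Type*} [Field F] {φ : F[X]} {k : ℕ} [NeZero k]

/-- The chart for two adjacent colors, given by the Heisenberg group. -/
noncomputable def adjacentChart [Fact (Irreducible φ)] (ht : AdjoinRoot.root φ ≠ 0) (hk : 2 ≤ k)
    (i : Fin (k + 1)) : LinkChart φ i (i + 1) (F × F × F) (F × F) (F × F) where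
  m v := heis φ i v.1 v.2.1 v.2.2
  injective_m := by
    rintro ⟨x, y, z⟩ ⟨x', y', z'⟩ he
    obtain ⟨rfl, rfl, rfl⟩ := heis_injective ht hk i he
    rfl
  mem_K v c h1 h2 := heis_mem_K φ h1 h2 _ _ _
  exists_eq g hg := by
    obtain ⟨x, y, z, rfl⟩ := exists_eq_heis φ hk hg
    exact ⟨(x, y, z), rfl⟩
  act₁ v a := (v.1 + a, v.2)
  act₂ v b := (v.1, v.2.1 + b, v.2.2 + v.1 * b)
  m_act₁ v a := (heis_mul_h φ hk i _ _ _ a).symm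
  m_act₂ v b := (heis_mul_h_succ φ hk i _ _ _ b).symm
  π₁ v := v.2
  -- Right multiplication by `h_{i+1}(b)` adds `b` to `y` and `x b` to `z`, so `x` and `z - x y` are
  -- its invariants.
  π₂ v := (v.1, v.2.2 - v.1 * v.2.1)
  surjective_π₁ v := ⟨(0, v), rfl⟩
  surjective_π₂ v := ⟨(v.1, 0, v.2), by simp⟩
  π₁_eq_iff := by
    rintro ⟨x, y⟩ ⟨x', y'⟩
    constructor
    · rintro rfl
      exact ⟨x' - x, by simp⟩
    · rintro ⟨a, ha⟩
      exact (congrArg Prod.snd ha).symm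
  π₂_eq_iff := by
    rintro ⟨x, y, z⟩ ⟨x', y', z'⟩
    simp only [Prod.mk.injEq]
    constructor
    · rintro ⟨rfl, hz⟩
      exact ⟨y' - y, rfl, by ring, by linear_combination -hz⟩
    · rintro ⟨a, rfl, rfl, rfl⟩
      exact ⟨rfl, by ring⟩

theorem forall_adjacentChart_act₁_iff [Fact (Irreducible φ)] (ht : AdjoinRoot.root φ ≠ 0)
    (hk : 2 ≤ k) (i : Fin (k + 1)) {d : ℕ} {f : F × F × F → F} :
    (∀ p, (fun a => f ((adjacentChart ht hk i).act₁ p a)) ∈ reedSolomon F d) ↔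
      ∀ y z, (fun x => f (x, y, z)) ∈ reedSolomon F d := by
  constructor
  · intro hf y z
    simpa [adjacentChart] using hf (0, y, z)
  · rintro hf ⟨x, y, z⟩
    simpa [adjacentChart, add_comm] using comp_affine_mem_reedSolomon (hf y z) 1 x

/-- Changing the base point of an orbit translates the parameter, which preserves Reed–Solomon
codes. So base points with `y = 0` suffice. -/
theorem forall_adjacentChart_act₂_iff [Fact (Irreducible φ)] (ht : AdjoinRoot.root φ ≠ 0)
    (hk : 2 ≤ k) (i : Fin (k + 1)) {d : ℕ} {f : F × F × F → F} :
    (∀ p, (fun a => f ((adjacentChart ht hk i).act₂ p a)) ∈ reedSolomon F d) ↔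
      ∀ x c, (fun y => f (x, y, x * y + c)) ∈ reedSolomon F d := by
  constructor
  · intro hf x c
    simpa [adjacentChart, add_comm] using hf (x, 0, c)
  · rintro hf ⟨x, y, z⟩
    have h1 := comp_affine_mem_reedSolomon (hf x (z - x * y)) 1 y
    have h2 : ∀ b, x * (1 * b + y) + (z - x * y) = z + x * b := fun b => by ring
    simp only [h2] at h1
    simpa [adjacentChart, add_comm] using h1

/-- The chart for two colors that are not adjacent, given by a product of two commuting groups. -/
noncomputable def nonadjacentChart [Fact (Irreducible φ)] (ht : AdjoinRoot.root φ ≠ 0)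
    {i j : Fin (k + 1)} (hij : i ≠ j) (h1 : i ≠ j + 1) (h2 : j ≠ i + 1) :
    LinkChart φ i j (F × F) F F where
  m v := h φ k j v.2 * h φ k i v.1
  injective_m v v' he := by
    obtain ⟨hr, hs⟩ := h_mul_h_injective ht hij h1 he
    exact Prod.ext hr hs
  mem_K v c hi hj := mul_mem (h_mem_K hj.symm _) (h_mem_K hi.symm _)
  exists_eq g hg := by
    obtain ⟨r, s, rfl⟩ := exists_eq_h_mul_h hij h1 h2 hg
    exact ⟨(r, s), rfl⟩
  act₁ v a := (v.1 + a, v.2)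
  act₂ v b := (v.1, v.2 + b)
  m_act₁ v a := by rw [h_add, mul_assoc]
  m_act₂ v b := by rw [mul_assoc, h_mul_h_comm h1 h2, h_add, mul_assoc]
  π₁ v := v.2
  π₂ v := v.1
  surjective_π₁ y := ⟨(0, y), rfl⟩
  surjective_π₂ x := ⟨(x, 0), rfl⟩
  π₁_eq_iff := by
    rintro ⟨x, y⟩ ⟨x', y'⟩
    simp only [Prod.mk.injEq]
    exact ⟨fun e => ⟨x' - x, by ring, e.symm⟩, fun ⟨_, _, e⟩ => e.symm⟩
  π₂_eq_iff := by
    rintro ⟨x, y⟩ ⟨x', y'⟩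
    simp only [Prod.mk.injEq]
    exact ⟨fun e => ⟨y' - y, e.symm, by ring⟩, fun ⟨_, e, _⟩ => e.symm⟩

theorem forall_nonadjacentChart_act₁_iff [Fact (Irreducible φ)] (ht : AdjoinRoot.root φ ≠ 0)
    {i j : Fin (k + 1)} (hij : i ≠ j) (h1 : i ≠ j + 1) (h2 : j ≠ i + 1) {d : ℕ} {f : F × F → F} :
    (∀ p, (fun a => f ((nonadjacentChart ht hij h1 h2).act₁ p a)) ∈ reedSolomon F d) ↔
      ∀ y, (fun x => f (x, y)) ∈ reedSolomon F d := by
  constructor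
  · intro hf y
    simpa [nonadjacentChart] using hf (0, y)
  · rintro hf ⟨x, y⟩
    simpa [nonadjacentChart, add_comm] using comp_affine_mem_reedSolomon (hf y) 1 x

theorem forall_nonadjacentChart_act₂_iff [Fact (Irreducible φ)] (ht : AdjoinRoot.root φ ≠ 0)
    {i j : Fin (k + 1)} (hij : i ≠ j) (h1 : i ≠ j + 1) (h2 : j ≠ i + 1) {d : ℕ} {f : F × F → F} :
    (∀ p, (fun a => f ((nonadjacentChart ht hij h1 h2).act₂ p a)) ∈ reedSolomon F d) ↔
      ∀ x, (fun y => f (x, y)) ∈ reedSolomon F d := by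
  constructor
  · intro hf x
    simpa [nonadjacentChart] using hf (x, 0)
  · rintro hf ⟨x, y⟩
    simpa [nonadjacentChart, add_comm] using comp_affine_mem_reedSolomon (hf x) 1 y

variable [Fact (Irreducible φ)] {d : ℕ} {s : Finset (CosetVertex (K φ k))} {g₀ : grp φ k}

theorem codeIso_vertexCode (ht : AdjoinRoot.root φ ≠ 0) (hk : 2 ≤ k) {i : Fin (k + 1)}
    (hs : color s = Finset.univ \ {i, i + 1}) (hg₀ : s ⊆ topFace (K φ k) g₀) :
    CodeIso (faceCode φ k d s) (vertexCode F d d) :=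
  (adjacentChart ht hk i).codeIso hs hg₀ fun f => by
    rw [forall_adjacentChart_act₁_iff, forall_adjacentChart_act₂_iff]
    exact Iff.rfl

variable [Fintype F]

theorem codeIso_tensorCode (ht : AdjoinRoot.root φ ≠ 0) (hd : d < Fintype.card F)
    {i j : Fin (k + 1)} (hij : i ≠ j) (h1 : i ≠ j + 1) (h2 : j ≠ i + 1)
    (hs : color s = Finset.univ \ {i, j}) (hg₀ : s ⊆ topFace (K φ k) g₀) :
    CodeIso (faceCode φ k d s) (tensorCode (reedSolomon F d) (reedSolomon F d)) :=
  (nonadjacentChart ht hij h1 h2).codeIso hs hg₀ fun f => by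
    rw [forall_nonadjacentChart_act₁_iff, forall_nonadjacentChart_act₂_iff,
      mem_tensorCode_reedSolomon_iff hd]

theorem card_subtype_congr {A : Type*} {P Q : A → Prop} (hPQ : ∀ a, P a ↔ Q a) :
    Nat.card {a // P a} = Nat.card {a // Q a} :=
  Nat.card_congr (Equiv.subtypeEquivRight hPQ)

theorem strictMonoOn_four_mul_rpow :
    StrictMonoOn (fun x : ℝ => 4 * x ^ ((1 : ℝ) / 3)) (Set.Ici 0) := fun _ hx _ _ hxy =>
  mul_lt_mul_of_pos_left (Real.rpow_lt_rpow hx hxy (by norm_num)) (by norm_num)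

theorem epsilon_pos {q : ℝ} {d : ℕ} (hd : 4 * d < q) : 0 < ((q - 4 * d) / (5 * q)) ^ 3 := by
  have h1 : 0 < q := lt_of_le_of_lt (by positivity) hd
  have h2 : 0 < q - 4 * d := sub_pos.2 hd
  positivity

theorem agreementTestable_adjacent (ht : AdjoinRoot.root φ ≠ 0) (hk : 2 ≤ k)
    (hd : 4 * d < Fintype.card F) {i : Fin (k + 1)} (hs : color s = Finset.univ \ {i, i + 1})
    (hg₀ : s ⊆ topFace (K φ k) g₀) (hcard : s.card + 1 = k) :
    AgreementTestable (complex φ k) k (faceCode φ k d) s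
      (((Fintype.card F - 4 * d : ℝ) / (5 * Fintype.card F)) ^ 3)
      (fun x => 4 * x ^ ((1 : ℝ) / 3)) := by
  refine (adjacentChart ht hk i).agreementTestable (ne_succ i) hs hg₀ hcard
    (epsilon_pos (by exact_mod_cast hd)) strictMonoOn_four_mul_rpow
    (fun x hx => by positivity) ?_
  intro u v hu hv α hα hlt
  rw [forall_adjacentChart_act₁_iff] at hu
  rw [forall_adjacentChart_act₂_iff] at hv
  obtain ⟨f, ⟨hf₁, hf₂⟩, hf⟩ := agreement_vertexCode hd hu hv (α := α) (by
    rw [← hα]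
    simp only [Nat.card_eq_fintype_card, Fintype.card_prod]
    push_cast
    ring) hlt
  refine ⟨f, (forall_adjacentChart_act₁_iff ht hk i).2 hf₁,
    (forall_adjacentChart_act₂_iff ht hk i).2 hf₂, ?_⟩
  have hL : (Nat.card (F × F) + Nat.card (F × F) : ℝ) = 2 * (Fintype.card F : ℝ) ^ 2 := by
    simp only [Nat.card_eq_fintype_card, Fintype.card_prod]
    push_cast
    ring
  rw [hL]
  refine le_trans (le_of_eq ?_) hf
  congr 2
  · refine congrArg Nat.cast (card_subtype_congr ?_)
    rintro ⟨y, z⟩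
    constructor
    · rintro ⟨⟨x, w⟩, rfl, hne⟩
      exact ⟨x, hne⟩
    · rintro ⟨x, hne⟩
      exact ⟨(x, y, z), rfl, hne⟩
  · refine congrArg Nat.cast (card_subtype_congr ?_)
    rintro ⟨x, c⟩
    constructor
    · rintro ⟨⟨x', y, z⟩, he, hne⟩
      obtain ⟨rfl, rfl⟩ : x' = x ∧ z - x' * y = c := Prod.mk.inj he
      exact ⟨y, by simpa using hne⟩
    · rintro ⟨y, hne⟩
      exact ⟨(x, y, x * y + c), by simp [adjacentChart], hne⟩

theorem agreementTestable_nonadjacent (ht : AdjoinRoot.root φ ≠ 0)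
    (hd : 4 * d < Fintype.card F) {i j : Fin (k + 1)} (hij : i ≠ j) (h1 : i ≠ j + 1)
    (h2 : j ≠ i + 1) (hs : color s = Finset.univ \ {i, j}) (hg₀ : s ⊆ topFace (K φ k) g₀)
    (hcard : s.card + 1 = k) :
    AgreementTestable (complex φ k) k (faceCode φ k d) s
      (((Fintype.card F - 4 * d : ℝ) / (5 * Fintype.card F)) ^ 3)
      (fun x => 4 * x ^ ((1 : ℝ) / 3)) := by
  refine (nonadjacentChart ht hij h1 h2).agreementTestable hij hs hg₀ hcard
    (epsilon_pos (by exact_mod_cast hd)) strictMonoOn_four_mul_rpow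
    (fun x hx => by positivity) ?_
  intro u v hu hv α hα hlt
  rw [forall_nonadjacentChart_act₁_iff] at hu
  rw [forall_nonadjacentChart_act₂_iff] at hv
  obtain ⟨f, hf₁, hf₂, hf⟩ := agreement_tensor hd hu hv (α := α) (by
    rw [← hα]
    simp only [Nat.card_eq_fintype_card, Fintype.card_prod]
    push_cast
    ring) hlt
  refine ⟨f, (forall_nonadjacentChart_act₁_iff ht hij h1 h2).2 hf₁,
    (forall_nonadjacentChart_act₂_iff ht hij h1 h2).2 hf₂, ?_⟩
  rw [← two_mul, Nat.card_eq_fintype_card (α := F)]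
  refine le_trans (le_of_eq ?_) hf
  congr 2
  · refine congrArg Nat.cast (card_subtype_congr fun y => ?_)
    constructor
    · rintro ⟨⟨x, w⟩, rfl, hne⟩
      exact ⟨x, hne⟩
    · rintro ⟨x, hne⟩
      exact ⟨(x, y), rfl, hne⟩
  · refine congrArg Nat.cast (card_subtype_congr fun x => ?_)
    constructor
    · rintro ⟨⟨x, w⟩, rfl, hne⟩
      exact ⟨w, hne⟩
    · rintro ⟨y, hne⟩
      exact ⟨(x, y), rfl, hne⟩

end Instances

/-! ### The two colors missing from a face of dimension `k - 2` -/

section Colors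

variable {F : Type*} [Field F] {φ : F[X]} {k : ℕ} [NeZero k]

theorem card_color {s : Finset (CosetVertex (K φ k))} (hs : s ∈ complex φ k) :
    (color s).card = s.card := by
  obtain ⟨g, hg⟩ := hs
  refine Finset.card_image_of_injOn fun v hv w hw hvw => ?_
  have h1 := hg v hv
  have h2 := hg w hw
  obtain ⟨c, x⟩ := v
  obtain ⟨c', y⟩ := w
  obtain rfl : c = c' := hvw
  simp only at h1 h2
  rw [h1, h2]

theorem exists_color_eq {s : Finset (CosetVertex (K φ k))} (hs : s ∈ complex φ k)
    (hcard : s.card + 1 = k) : ∃ i j, i ≠ j ∧ color s = Finset.univ \ {i, j} := by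
  have h1 : (color s)ᶜ.card = 2 := by
    rw [Finset.card_compl, card_color hs, Fintype.card_fin]
    omega
  obtain ⟨i, j, hij, he⟩ := Finset.card_eq_two.1 h1
  exact ⟨i, j, hij, by rw [← Finset.compl_eq_univ_sdiff, ← he, compl_compl]⟩

theorem IsPrimitivePolynomial.root_ne_zero (hφ : IsPrimitivePolynomial φ) :
    AdjoinRoot.root φ ≠ 0 := by
  have : Fact (Irreducible φ) := ⟨hφ.1⟩
  obtain ⟨u, hu, -⟩ := hφ.2
  exact hu ▸ u.ne_zero

end Colors

end HDXCode

theorem mainTheorem11 (k : ℕ) [NeZero k] (hk : 2 < k) (p : ℕ) [Fact p.Prime]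
    (φ : (ZMod p)[X]) (hφ : HDXCode.IsPrimitivePolynomial φ)
    (d : ℕ) (hd : (d : ℝ) < p / 4)
    (s : Finset (HDXCode.CosetVertex (HDXCode.K φ k)))
    (hs : s ∈ HDXCode.facesOfDim (HDXCode.complex φ k) (k - 2)) :
    (∀ i j : Fin (k + 1), i ≠ j → HDXCode.color s = Finset.univ \ {i, j} →
      ((i = j + 1 ∨ j = i + 1) →
        HDXCode.CodeIso (HDXCode.faceCode φ k d s) (HDXCode.vertexCode (ZMod p) d d)) ∧
      (¬ (i = j + 1 ∨ j = i + 1) →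
        HDXCode.CodeIso (HDXCode.faceCode φ k d s)
          (HDXCode.tensorCode (HDXCode.reedSolomon (ZMod p) d)
            (HDXCode.reedSolomon (ZMod p) d)))) ∧
    HDXCode.AgreementTestable (HDXCode.complex φ k) k (HDXCode.faceCode φ k d) s
      ((((p : ℝ) - 4 * d) / (5 * p)) ^ 3) (fun x => 4 * x ^ ((1 : ℝ) / 3)) := by
  have : Fact (Irreducible φ) := ⟨hφ.1⟩
  have ht := hφ.root_ne_zero
  have hq : 4 * d < Fintype.card (ZMod p) := by
    rw [ZMod.card]
    have : (4 * d : ℝ) < p := by linarith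
    exact_mod_cast this
  obtain ⟨hsX, hsc⟩ := hs
  have hcard : s.card + 1 = k := by omega
  obtain ⟨g₀, hg₀⟩ := HDXCode.exists_subset_topFace hsX
  refine ⟨fun i j hij hc => ⟨?_, fun hn => ?_⟩, ?_⟩
  · rintro (rfl | rfl)
    -- The Heisenberg chart expects the pair as `{i, i + 1}`, so the colors are reordered when `i`
    -- is the successor.
    · rw [Finset.pair_comm] at hc
      exact HDXCode.codeIso_vertexCode ht hk.le hc hg₀
    · exact HDXCode.codeIso_vertexCode ht hk.le hc hg₀
  · rw [not_or] at hn
    exact HDXCode.codeIso_tensorCode ht (by omega) hij hn.1 hn.2 hc hg₀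
  · obtain ⟨i, j, hij, hc⟩ := HDXCode.exists_color_eq hsX hcard
    have hp : (p : ℝ) = Fintype.card (ZMod p) := by rw [ZMod.card]
    rw [hp]
    by_cases h1 : i = j + 1
    · subst h1
      rw [Finset.pair_comm] at hc
      exact HDXCode.agreementTestable_adjacent ht hk.le hq hc hg₀ hcard
    by_cases h2 : j = i + 1
    · subst h2
      exact HDXCode.agreementTestable_adjacent ht hk.le hq hc hg₀ hcard
    · exact HDXCode.agreementTestable_nonadjacent ht hq hij h1 h2 hc hg₀ hcard
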